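/- **Setting.** Let $E,F$ be real Banach spaces, $T>0$, $p\ge 1$, $N=\lfloor p\rfloor$. *Trees.* A rooted tree is a finite poset with a unique minimal element (the root) in which the set of vertices below any given vertex is totally ordered; a non-planar rooted tree $\mathfrak t$ is an isomorphism class of these. Its degree $|\mathfrak t|$ is the number of non-root vertices, and $\mathrm{SG}(\mathfrak t)$ is the group of order automorphisms of the set of non-root vertices. Fix a symmetric system of cross (semi)norms on the tensor powers $E^{\otimes n}$ (that is $\|a\otimes b\|=\|a\|\,\|b\|$, permutations of the factors are isometric, and the norms on $E^{\otimes 0}=\mathbb R$ and $E^{\otimes 1}=E$ are the given ones) such that for $n\le N$ every continuous $n$-linear map on $E$ extends continuously to the completion $E^{\hat\otimes n}$, i.e. the projective norm is bounded by a constant multiple of the chosen one (for instance: the projective norms; any such system if $\dim E<\infty$). Let $E^{\hat\otimes\mathfrak t}=E^{\hat\otimes|\mathfrak t|}/\ker(\mathrm{sym}_{\mathrm{SG}(\mathfrak t)})$ with the quotient norm, where $\mathrm{sym}_{\mathrm{SG}(\mathfrak t)}$ is the averaging over $\mathrm{SG}(\mathfrak t)$ permuting tensor factors; its elements are trees of shape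 $\mathfrak t$ with non-root vertices labelled by $E$ (multilinearly). Let $\widehat{\mathfrak{Tr}}(E)=\prod_{\mathfrak t}E^{\hat\otimes\mathfrak t}$ with the product topology, $\pi^k$ the projection to the trees of degree $k$ (with the sum norm on this finite direct sum), and $\pi^{(N)}$ the truncation to trees of degree $\le N$, with range $\widehat{\mathfrak{Tr}}^{(N)}(E)$. The Grossman–Larson product $\mathbf t\star\mathbf s$ is the sum, over all maps $d$ from the children of the root of $\mathbf t$ to the vertices of $\mathbf s$, of the tree obtained by removing the root of $\mathbf t$ and attaching each such child $v$ to $d(v)$. The coproduct $\Delta_{\mathrm{GL}}(\mathbf t)$ is the sum, over all subsets $I$ of the set of children of the root, of $\mathbf t_I\otimes\mathbf t_{I^c}$, where $\mathbf t_I$ consists of the root and the branches starting in $I$. Both are extended (bi)linearly and continuously. An element $g\neq 0$ is group-like if $\Delta_{\mathrm{GL}}g=g\otimes g$. *Rough paths.* Let $\Delta_T=\{0\le s\le t\le T\}$. A control is a continuous $\omega:\Delta_T\to[0,\infty)$ with $\omega(s,s)=0$ and $\omega(s,t)+\omega(t,u)\le\omega(s,u)$ for $s\le t\le u$. A branched $p$-rough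 path controlled by $\omega$ is a continuous map $\mathbf x:\Delta_T\to\widehat{\mathfrak{Tr}}^{(N)}(E)$ such that $\mathbf x_{s,u}=\pi^{(N)}(\mathbf x_{s,t}\star\mathbf x_{t,u})$ for $s\le t\le u$, each $\mathbf x_{s,t}$ is of the form $\pi^{(N)}(g)$ with $g$ group-like, and $\|\pi^k(\mathbf x_{s,t})\|\le\omega(s,t)^{k/p}$ for $1\le k\le N$. *Elementary differentials and RDEs.* Let $(V_e)_{e\in E}$ be vector fields depending linearly on $e$, let $\nabla$ be a connection $(Y,X)\mapsto\nabla_YX$ and $f$ a function with values in a Banach space, all smooth on an open subset $O$ of $F$. For $q\in O$ the map $\Psi_{V,f,q,\nabla}$ on $\widehat{\mathfrak{Tr}}^{(N)}(E)$ is the continuous linear map whose value on a labelled tree is obtained by letting the root correspond to $f$ and a vertex with label $e$ to $V_e$: a vertex with $k$ children contributes the $k$-th iterated covariant derivative with respect to $\nabla$ at $q$ of the corresponding object, applied to the vectors contributed by its children. For the canonical connection $\nabla_YX=X'[Y]$ of $F$ these are the ordinary Fréchet derivatives. A path $y$ in $O$ *solves* $\mathrm dy_t=V(y_t)\,\mathrm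 d\mathbf x_t$ *with respect to* $\nabla$ (with initial value $y_0$) if there is $\theta:\mathbb R\to\mathbb R$ with $\theta(h)=o(h)$ as $h\to0$ (in particular $\theta(0)=0$) such that $$\|y_t-\Psi_{V,\mathrm{id},y_s,\nabla}(\mathbf x_{s,t})\|\le\theta(\omega(s,t))\qquad\text{for all }(s,t)\in\Delta_T.$$ **Corollary (coordinate invariance of RDEs).** Let $V:E\times F\to F$, $(e,q)\mapsto V_e(q)$, be continuous, linear in $e$, and smooth (in the Fréchet sense) in $q$. Let $\mathbf x$ be a branched $p$-rough path controlled by a control $\omega$, and let $y:[0,T]\to F$ be a continuous path with $y_t\in U$ for all $t\in[0,T]$, where $U\subset F$ is open. Let $W\subset F$ be open, let $\varphi:U\to W$ be a smooth diffeomorphism, and define on $W$ the pushforward vector fields $$\tilde V_e(q)=\varphi'(\varphi^{-1}(q))[V_e(\varphi^{-1}(q))],\qquad e\in E,$$ and the pushforward connection $$\tilde\nabla_{\tilde Y}\tilde X(q)=\tilde X'(q)[\tilde Y(q)]-\varphi''(\varphi^{-1}(q))\big[(\varphi'(\varphi^{-1}(q)))^{-1}[\tilde X(q)],(\varphi'(\varphi^{-1}(q)))^{-1}[\tilde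 Y(q)]\big].$$ Then $y$ solves $\mathrm dy_t=V(y_t)\,\mathrm d\mathbf x_t$ with respect to the canonical connection on $F$ if and only if $\tilde y_t:=\varphi(y_t)$ solves $\mathrm d\tilde y_t=\tilde V(\tilde y_t)\,\mathrm d\mathbf x_t$ with respect to $\tilde\nabla$. -/

import Mathlib

open scoped TensorProduct Topology

noncomputable section

/-! ### Non-planar rooted trees -/

/-- A rooted tree whose non-root vertices are enumerated by `ι`. The root is the (implicit) unique
minimal element below all of `ι`; the order on the non-root vertices is a partial order such that
the vertices below a given vertex are totally ordered. A non-planar rooted tree of degree `n` is an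
orbit of such structures on `Fin n` under relabelling of the vertices, and the stabiliser of a
structure is its symmetry group. -/
@[ext]
structure RTree (ι : Type) where
  le : ι → ι → Prop
  le_refl : ∀ a, le a a
  le_trans : ∀ a b c, le a b → le b c → le a c
  le_antisymm : ∀ a b, le a b → le b a → a = b
  chain : ∀ a b c, le a c → le b c → le a b ∨ le b a

namespace RTree

variable {ι κ : Type}

instance [Finite ι] : Finite (RTree ι) :=
  Finite.of_injective (fun τ : RTree ι => τ.le) fun _ _ h => RTree.ext h

instance [Finite ι] : Fintype (RTree ι) := Fintype.ofFinite _

/-- Strict order on the non-root vertices. -/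
def lt (τ : RTree ι) (a b : ι) : Prop := τ.le a b ∧ a ≠ b

/-- Pull the order back along an injective map (restriction, or relabelling for a bijection). -/
def comap (f : κ ↪ ι) (τ : RTree ι) : RTree κ where
  le a b := τ.le (f a) (f b)
  le_refl _ := τ.le_refl _
  le_trans _ _ _ := τ.le_trans _ _ _
  le_antisymm _ _ h₁ h₂ := f.injective (τ.le_antisymm _ _ h₁ h₂)
  chain _ _ _ := τ.chain _ _ _

open Classical in
/-- The children of the root: the minimal elements among the non-root vertices. -/
def roots [Fintype ι] (τ : RTree ι) : Finset ι :=
  Finset.univ.filter fun v => ∀ w, ¬ τ.lt w v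

open Classical in
/-- The children of a non-root vertex. -/
def children [Fintype ι] (τ : RTree ι) (v : ι) : Finset ι :=
  Finset.univ.filter fun w => τ.lt v w ∧ ∀ u, ¬ (τ.lt v u ∧ τ.lt u w)

open Classical in
/-- All vertices lying (weakly) above some vertex of `I`. -/
def branches [Fintype ι] (τ : RTree ι) (I : Finset ι) : Finset ι :=
  Finset.univ.filter fun v => ∃ r ∈ I, τ.le r v

theorem mem_children [Fintype ι] {τ : RTree ι} {v w : ι} :
    w ∈ τ.children v ↔ τ.lt v w ∧ ∀ u, ¬ (τ.lt v u ∧ τ.lt u w) := by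
  classical
  simp [children]

theorem eq_of_mem_roots [Fintype ι] {τ : RTree ι} {r s : ι} (hr : r ∈ τ.roots) (h : τ.le s r) :
    s = r := by
  classical
  by_contra hne
  have := (Finset.mem_filter.1 hr).2 s
  exact this ⟨h, hne⟩

theorem le_of_mem_roots [Fintype ι] {τ : RTree ι} {r a c : ι} (hr : r ∈ τ.roots)
    (h₁ : τ.le r c) (h₂ : τ.le a c) : τ.le r a := by
  rcases τ.chain _ _ _ h₁ h₂ with h | h
  · exact h
  · rw [eq_of_mem_roots hr h]; exact τ.le_refl _

/-- Grafting of `τ` onto `υ` along a grafting map `d`, which assigns to every child of the root of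
`τ` a vertex of `υ` (`none` stands for the root of `υ`). The vertex set is the disjoint union
of the sets of non-root vertices of `τ` and `υ`, together with the root of `υ`. -/
def graft [Fintype ι] (τ : RTree ι) (υ : RTree κ) (d : {r // r ∈ τ.roots} → Option κ) :
    RTree (ι ⊕ κ) where
  le
    | .inl a, .inl b => τ.le a b
    | .inr a, .inr b => υ.le a b
    | .inr a, .inl b => ∃ r : {r // r ∈ τ.roots}, τ.le r b ∧ ∃ c, d r = some c ∧ υ.le a c
    | .inl _, .inr _ => False
  le_refl := by
    rintro (a | a)
    exacts [τ.le_refl a, υ.le_refl a]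
  le_trans := by
    rintro (a | a) (b | b) (c | c) h₁ h₂
    · exact τ.le_trans _ _ _ h₁ h₂
    · exact h₂
    · exact h₁.elim
    · exact h₁.elim
    · obtain ⟨r, h, q⟩ := h₁
      exact ⟨r, τ.le_trans _ _ _ h h₂, q⟩
    · exact h₂.elim
    · obtain ⟨r, h, e, q, q'⟩ := h₂
      exact ⟨r, h, e, q, υ.le_trans _ _ _ h₁ q'⟩
    · exact υ.le_trans _ _ _ h₁ h₂
  le_antisymm := by
    rintro (a | a) (b | b) h₁ h₂
    · rw [τ.le_antisymm _ _ h₁ h₂]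
    · exact h₁.elim
    · exact h₂.elim
    · rw [υ.le_antisymm _ _ h₁ h₂]
  chain := by
    rintro (a | a) (b | b) (c | c) h₁ h₂
    · exact τ.chain _ _ _ h₁ h₂
    · exact h₁.elim
    · obtain ⟨r, h, q⟩ := h₂
      exact Or.inr ⟨r, le_of_mem_roots r.2 h h₁, q⟩
    · exact h₁.elim
    · obtain ⟨r, h, q⟩ := h₁
      exact Or.inl ⟨r, le_of_mem_roots r.2 h h₂, q⟩
    · exact h₂.elim
    · obtain ⟨r, h, e, q, q'⟩ := h₁
      obtain ⟨r₂, h₂, e₂, q₂, q₂'⟩ := h₂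
      have hrr : r = r₂ := Subtype.ext
        (eq_of_mem_roots r₂.2 (le_of_mem_roots r.2 h h₂))
      subst hrr
      rw [q] at q₂
      cases q₂
      exact υ.chain _ _ _ q' q₂'
    · exact υ.chain _ _ _ h₁ h₂

end RTree

/-! ### Symmetric systems of cross norms and completed tensor powers -/

/-- A symmetric system of cross (semi)norms on the tensor powers of the normed space `E`. -/
structure SymmCrossNorm (E : Type*) [NormedAddCommGroup E] [NormedSpace ℝ E] where
  /-- the seminorm on the `n`-th tensor power -/
  nrm : ∀ n : ℕ, Seminorm ℝ (⨂[ℝ]^n E)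
  nrm_zero : nrm 0 (PiTensorProduct.tprod ℝ ![]) = 1
  nrm_one : ∀ v : E, nrm 1 (PiTensorProduct.tprod ℝ ![v]) = ‖v‖
  cross : ∀ (m n : ℕ) (a : ⨂[ℝ]^m E) (b : ⨂[ℝ]^n E),
    nrm (m + n) (TensorPower.mulEquiv (a ⊗ₜ[ℝ] b)) = nrm m a * nrm n b
  symm : ∀ (n : ℕ) (σ : Equiv.Perm (Fin n)) (a : ⨂[ℝ]^n E),
    nrm n (PiTensorProduct.reindex ℝ (fun _ => E) σ a) = nrm n a

variable {E : Type*} [NormedAddCommGroup E] [NormedSpace ℝ E] (ν : SymmCrossNorm E)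

/-- Up to degree `N`, continuous multilinear maps on `E` extend continuously to the completed
tensor powers; equivalently, the cross norms dominate the projective norms up to constants. -/
def SymmCrossNorm.DominatesProjective (N : ℕ) : Prop :=
  ∀ n ≤ N, ∃ C : ℝ, ∀ a : ⨂[ℝ]^n E,
    PiTensorProduct.projectiveSeminorm a ≤ C * ν.nrm n a

/-- The algebraic tensor power, as a seminormed space under the given cross norm. -/
def TPow (_ : SymmCrossNorm E) (n : ℕ) : Type _ := ⨂[ℝ]^n E

instance (n : ℕ) : AddCommGroup (TPow ν n) := inferInstanceAs (AddCommGroup (⨂[ℝ]^n E))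

instance (n : ℕ) : Module ℝ (TPow ν n) := inferInstanceAs (Module ℝ (⨂[ℝ]^n E))

/-- The identity map between the two copies of the algebraic tensor power. -/
def TPow.equiv (n : ℕ) : TPow ν n ≃ₗ[ℝ] (⨂[ℝ]^n E) where
  toFun a := a
  invFun a := a
  map_add' _ _ := rfl
  map_smul' _ _ := rfl
  left_inv _ := rfl
  right_inv _ := rfl

instance (n : ℕ) : SeminormedAddCommGroup (TPow ν n) :=
  AddGroupSeminorm.toSeminormedAddCommGroup
    ((ν.nrm n).comp (TPow.equiv ν n).toLinearMap).toAddGroupSeminorm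

theorem TPow.norm_eq {n : ℕ} (a : TPow ν n) : ‖a‖ = ν.nrm n (TPow.equiv ν n a) := rfl

instance (n : ℕ) : NormedSpace ℝ (TPow ν n) where
  norm_smul_le c a := by
    rw [TPow.norm_eq, TPow.norm_eq, map_smul, map_smul_eq_mul]

/-- The completed tensor power of `E`. -/
abbrev CPow (n : ℕ) : Type _ := UniformSpace.Completion (TPow ν n)

/-- The canonical embedding of the algebraic tensor power into its completion. -/
def toCPow (n : ℕ) : TPow ν n →L[ℝ] CPow ν n := UniformSpace.Completion.toComplL

/-- Elementary tensors in the completed tensor power. -/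
def pureC {n : ℕ} (e : Fin n → E) : CPow ν n :=
  toCPow ν n ((TPow.equiv ν n).symm (PiTensorProduct.tprod ℝ e))

theorem denseRange_toCPow (n : ℕ) : DenseRange (toCPow ν n) :=
  UniformSpace.Completion.denseRange_coe

theorem isUniformInducing_toCPow (n : ℕ) : IsUniformInducing (toCPow ν n) :=
  UniformSpace.Completion.isUniformInducing_coe _

theorem norm_toCPow {n : ℕ} (a : TPow ν n) : ‖toCPow ν n a‖ = ‖a‖ :=
  UniformSpace.Completion.norm_coe a

/-- Continuous linear maps on the completed tensor power are determined by elementary tensors. -/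
theorem CPow.ext_pureC {G : Type*} [NormedAddCommGroup G] [NormedSpace ℝ G] {n : ℕ}
    {L M : CPow ν n →L[ℝ] G} (h : ∀ e, L (pureC ν e) = M (pureC ν e)) : L = M := by
  have h₁ : (L ∘L toCPow ν n).toLinearMap ∘ₗ (TPow.equiv ν n).symm.toLinearMap
      = (M ∘L toCPow ν n).toLinearMap ∘ₗ (TPow.equiv ν n).symm.toLinearMap :=
    PiTensorProduct.ext (MultilinearMap.ext fun e => h e)
  refine ContinuousLinearMap.coeFn_injective
    ((denseRange_toCPow ν n).equalizer L.continuous M.continuous ?_)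
  funext a
  exact LinearMap.congr_fun h₁ (TPow.equiv ν n a)

/-- Permutation of tensors, on the algebraic tensor power. -/
def permA {n : ℕ} (σ : Equiv.Perm (Fin n)) : TPow ν n →L[ℝ] TPow ν n :=
  LinearMap.mkContinuous ((TPow.equiv ν n).symm.toLinearMap ∘ₗ
    (PiTensorProduct.reindex ℝ (fun _ => E) σ).toLinearMap ∘ₗ (TPow.equiv ν n).toLinearMap) 1
    fun a => by
      rw [one_mul]
      exact (ν.symm n σ (TPow.equiv ν n a)).le

/-- Permutation of tensors on the completed tensor power: the factor in position `i` is moved to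
position `σ i`, see `permC_pureC`. -/
def permC {n : ℕ} (σ : Equiv.Perm (Fin n)) : CPow ν n →L[ℝ] CPow ν n :=
  (toCPow ν n ∘L permA ν σ).extend (toCPow ν n)

theorem permC_pureC {n : ℕ} (σ : Equiv.Perm (Fin n)) (e : Fin n → E) :
    permC ν σ (pureC ν e) = pureC ν fun i => e (σ.symm i) := by
  unfold permC
  rw [pureC, ContinuousLinearMap.extend_eq _ (denseRange_toCPow ν n)
    (isUniformInducing_toCPow ν n), ContinuousLinearMap.comp_apply, pureC]
  congr 1
  exact congrArg (TPow.equiv ν n).symm (PiTensorProduct.reindex_tprod σ e)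

theorem SymmCrossNorm.nrm_cast {m n : ℕ} (h : m = n) (a : ⨂[ℝ]^m E) :
    ν.nrm n (TensorPower.cast ℝ E h a) = ν.nrm m a := by
  subst h
  rw [TensorPower.cast_refl]
  rfl

/-- Tensor multiplication on algebraic tensor powers. -/
def mulA {m n k : ℕ} (h : m + n = k) : TPow ν m →L[ℝ] TPow ν n →L[ℝ] TPow ν k :=
  LinearMap.mkContinuous₂
    (LinearMap.mk₂ ℝ (fun a b => (TPow.equiv ν k).symm (TensorPower.cast ℝ E h
        (TensorPower.mulEquiv (TPow.equiv ν m a ⊗ₜ[ℝ] TPow.equiv ν n b))))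
      (fun a a' b => by simp only [map_add, TensorProduct.add_tmul])
      (fun c a b => by rw [map_smul, ← TensorProduct.smul_tmul', map_smul, map_smul, map_smul])
      (fun a b b' => by simp only [map_add, TensorProduct.tmul_add])
      (fun c a b => by simp only [map_smul, TensorProduct.tmul_smul])) 1
    fun a b => by
      rw [one_mul]
      exact ((ν.nrm_cast h _).trans (ν.cross m n _ _)).le

/-- Extension of a continuous linear map to the completion, as a continuous linear operation. -/
def extendC (n k : ℕ) : (TPow ν n →L[ℝ] CPow ν k) →L[ℝ] (CPow ν n →L[ℝ] CPow ν k) :=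
  LinearMap.mkContinuous
    { toFun := fun f => f.extend (toCPow ν n)
      map_add' := fun f g => by
        refine ContinuousLinearMap.extend_unique _ (denseRange_toCPow ν n)
          (isUniformInducing_toCPow ν n) _ ?_
        ext a
        simp [ContinuousLinearMap.extend_eq _ (denseRange_toCPow ν n)
          (isUniformInducing_toCPow ν n)]
      map_smul' := fun c f => by
        refine ContinuousLinearMap.extend_unique _ (denseRange_toCPow ν n)
          (isUniformInducing_toCPow ν n) _ ?_
        ext a
        simp [ContinuousLinearMap.extend_eq _ (denseRange_toCPow ν n)
          (isUniformInducing_toCPow ν n)] } 1 fun f => by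
    rw [one_mul]
    refine ContinuousLinearMap.opNorm_le_bound _ (norm_nonneg _) fun x => ?_
    refine (denseRange_toCPow ν n).induction_on x
      (isClosed_le (by fun_prop) (by fun_prop)) fun a => ?_
    simp only [LinearMap.coe_mk, AddHom.coe_mk]
    rw [ContinuousLinearMap.extend_eq _ (denseRange_toCPow ν n) (isUniformInducing_toCPow ν n),
      norm_toCPow]
    exact f.le_opNorm a

/-- Tensor multiplication on completed tensor powers, see `mulC_pureC`. -/
def mulC {m n k : ℕ} (h : m + n = k) : CPow ν m →L[ℝ] CPow ν n →L[ℝ] CPow ν k :=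
  (extendC ν n k ∘L ContinuousLinearMap.compL ℝ _ _ _ (toCPow ν k) ∘L mulA ν h).extend
    (toCPow ν m)

theorem mulC_pureC {m n k : ℕ} (h : m + n = k) (a : Fin m → E) (b : Fin n → E) :
    mulC ν h (pureC ν a) (pureC ν b)
      = pureC ν fun i => Fin.append a b (Fin.cast h.symm i) := by
  subst h
  unfold mulC
  rw [pureC, ContinuousLinearMap.extend_eq _ (denseRange_toCPow ν m)
    (isUniformInducing_toCPow ν m)]
  change ((toCPow ν _ ∘L mulA ν rfl _).extend (toCPow ν n)) (pureC ν b) = _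
  rw [pureC, ContinuousLinearMap.extend_eq _ (denseRange_toCPow ν n)
    (isUniformInducing_toCPow ν n), ContinuousLinearMap.comp_apply, pureC]
  congr 1
  refine congrArg (TPow.equiv ν _).symm ?_
  exact (congrArg _ (TensorPower.tprod_mul_tprod ℝ a b)).trans (TensorPower.cast_tprod ℝ E rfl _)

/-! ### The completed tree algebra -/

/-- Formal finite sums of labelled trees of degree `n`: the family `x` stands for
the sum over all `τ` of the tree `τ` labelled by the tensor `x τ`. -/
abbrev RawTree (n : ℕ) : Type _ := RTree (Fin n) → CPow ν n

/-- Averaging over all relabellings of the vertices. On a tree `τ` labelled by a tensor, this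
includes the averaging of the tensor over the symmetry group of `τ`. -/
def symL (n : ℕ) : RawTree ν n →ₗ[ℝ] RawTree ν n where
  toFun x τ := (n.factorial : ℝ)⁻¹ •
    ∑ σ : Equiv.Perm (Fin n), permC ν σ (x (τ.comap σ.toEmbedding))
  map_add' x y := by
    funext τ
    simp only [Pi.add_apply, map_add, Finset.sum_add_distrib, smul_add]
  map_smul' c x := by
    funext τ
    simp only [Pi.smul_apply, map_smul, Finset.smul_sum, RingHom.id_apply]
    exact Finset.sum_congr rfl fun σ _ => smul_comm _ _ _

/-- The degree `n` part of the completed tree algebra, i.e. the direct sum over all non-planar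
trees `t` of degree `n` of the completed `t`-tensor power: the quotient of the space of
formal sums of enumerated labelled trees by the kernel of the symmetrisation, realised as the image
of the symmetrisation. -/
def TreeSpace (n : ℕ) : Submodule ℝ (RawTree ν n) := LinearMap.range (symL ν n)

/-- The class of a formal sum of labelled trees. -/
def treeClass (n : ℕ) : RawTree ν n →ₗ[ℝ] TreeSpace ν n := (symL ν n).rangeRestrict

/-- The norm on the degree `n` part. On the summand of a tree `t` this is the quotient norm
of the completed `t`-tensor power, and the (finite) direct sum carries the sum norm. -/
def treeNorm {n : ℕ} (x : TreeSpace ν n) : ℝ := ∑ τ, ‖(x : RawTree ν n) τ‖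

/-- The completed tree algebra, with the product topology. -/
abbrev TreeAlg : Type _ := ∀ n : ℕ, TreeSpace ν n

/-- Truncation at degree `N`; the truncated tree algebra is the space of elements without
components of degree larger than `N`. -/
def trunc (N : ℕ) (x : TreeAlg ν) : TreeAlg ν := fun n => if n ≤ N then x n else 0

open Classical in
/-- Sum over all grafting maps, for homogeneous formal sums of trees of degree `m` and `n`. -/
def rawGraft {m n k : ℕ} (h : m + n = k) (x : RawTree ν m) (y : RawTree ν n) : RawTree ν k :=
  fun ρ => ∑ τ : RTree (Fin m), ∑ υ : RTree (Fin n),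
    ∑ d : {r // r ∈ τ.roots} → Option (Fin n),
      if (τ.graft υ d).comap ((finSumFinEquiv.trans (finCongr h)).symm.toEmbedding) = ρ
      then mulC ν h (x τ) (y υ) else 0

/-- The Grossman-Larson product. -/
def star (x y : TreeAlg ν) : TreeAlg ν := fun k =>
  ∑ q : {q : ℕ × ℕ // q ∈ Finset.HasAntidiagonal.antidiagonal k},
    treeClass ν k (rawGraft ν (Finset.HasAntidiagonal.mem_antidiagonal.1 q.2)
      (x q.1.1 : RawTree ν q.1.1) (y q.1.2 : RawTree ν q.1.2))

open Classical in
/-- The component of bidegree `(m, n)` of the Grossman-Larson coproduct. The sum ranges over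
all subsets `I` of the set of children of the root; the vertices above `I` and the remaining
vertices form the two trees `α` and `β`, enumerated in increasing order, and the
tensor factors are rearranged accordingly. -/
def coprod (m n : ℕ) (x : RawTree ν (m + n)) (α : RTree (Fin m)) (β : RTree (Fin n)) :
    CPow ν (m + n) :=
  ∑ τ : RTree (Fin (m + n)), ∑ I ∈ τ.roots.powerset,
    if h : (τ.branches I).card = m ∧ (τ.branches I)ᶜ.card = n then
      if τ.comap (Function.Embedding.inl.trans (finSumEquivOfFinset h.1 h.2).toEmbedding) = α ∧
          τ.comap (Function.Embedding.inr.trans (finSumEquivOfFinset h.1 h.2).toEmbedding) = β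
      then permC ν ((finSumEquivOfFinset h.1 h.2).symm.trans finSumFinEquiv) (x τ) else 0
    else 0

/-- Group-like elements: non-zero elements whose Grossman-Larson coproduct is their tensor square.
Both sides are families of tensors that are invariant under separate relabellings of the
two trees. -/
def IsGroupLike (g : TreeAlg ν) : Prop :=
  g ≠ 0 ∧ ∀ (m n : ℕ) (α : RTree (Fin m)) (β : RTree (Fin n)),
    coprod ν m n (g (m + n) : RawTree ν (m + n)) α β
      = mulC ν rfl ((g m : RawTree ν m) α) ((g n : RawTree ν n) β)

/-! ### Branched rough paths -/

/-- The simplex of times `0 ≤ s ≤ t ≤ T`. -/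
def simplex (T : ℝ) : Set (ℝ × ℝ) := {q | 0 ≤ q.1 ∧ q.1 ≤ q.2 ∧ q.2 ≤ T}

/-- Control functions on `[0, T]`. -/
structure IsControl (T : ℝ) (ω : ℝ → ℝ → ℝ) : Prop where
  continuousOn : ContinuousOn (fun q : ℝ × ℝ => ω q.1 q.2) (simplex T)
  nonneg : ∀ s t, 0 ≤ s → s ≤ t → t ≤ T → 0 ≤ ω s t
  diag : ∀ s, 0 ≤ s → s ≤ T → ω s s = 0
  superadd : ∀ s t u, 0 ≤ s → s ≤ t → t ≤ u → u ≤ T → ω s t + ω t u ≤ ω s u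

/-- Branched `p`-rough paths on `[0, T]` controlled by `ω`. -/
structure IsBranchedRoughPath (p T : ℝ) (ω : ℝ → ℝ → ℝ) (x : ℝ → ℝ → TreeAlg ν) : Prop where
  continuousOn : ContinuousOn (fun q : ℝ × ℝ => x q.1 q.2) (simplex T)
  mul : ∀ s t u, 0 ≤ s → s ≤ t → t ≤ u → u ≤ T →
    x s u = trunc ν ⌊p⌋₊ (star ν (x s t) (x t u))
  groupLike : ∀ s t, 0 ≤ s → s ≤ t → t ≤ T → ∃ g, IsGroupLike ν g ∧ x s t = trunc ν ⌊p⌋₊ g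
  bound : ∀ s t, 0 ≤ s → s ≤ t → t ≤ T → ∀ k, 1 ≤ k → k ≤ ⌊p⌋₊ →
    treeNorm ν (x s t k) ≤ ω s t ^ ((k : ℝ) / p)

/-! ### Connections and elementary differentials -/

variable {F G : Type*} [NormedAddCommGroup F] [NormedSpace ℝ F]
  [NormedAddCommGroup G] [NormedSpace ℝ G]

/-- The canonical (flat) connection of the vector space `F`: `∇_Y X`. -/
def canonicalConnection (Y X : F → F) (q : F) : F := fderiv ℝ X q (Y q)

/-- The pushforward under `φ` of the canonical connection, at points of the target of `φ`. -/
def pushforwardConnection (φ : OpenPartialHomeomorph F F) (Y X : F → F) (q : F) : F :=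
  fderiv ℝ X q (Y q) - fderiv ℝ (fderiv ℝ φ) (φ.symm q)
    ((fderiv ℝ φ (φ.symm q)).inverse (X q)) ((fderiv ℝ φ (φ.symm q)).inverse (Y q))

/-- The pushforward of a vector field under `φ`, at points of the target of `φ`. -/
def pushforwardField (φ : OpenPartialHomeomorph F F) (X : F → F) (q : F) : F :=
  fderiv ℝ φ (φ.symm q) (X (φ.symm q))

/-- The `k`-th covariant derivative `(∇ᵏ f)(w₀, …, w_{k-1})` at a point of a vector-valued function
`f` on (an open subset of) `F`, for a connection `∇` given as `(Y, X) ↦ ∇_Y X`. It is given by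
`(∇ᵏ⁺¹ f)(w₀, w) = w₀ ((∇ᵏ f)(w)) - ∑ i, (∇ᵏ f)(…, ∇_{w₀} wᵢ, …)`, where the tangent vectors are
extended to constant vector fields. -/
def covDerivFun (nabla : (F → F) → (F → F) → F → F) (f : F → G) :
    ∀ k : ℕ, F → (Fin k → F) → G
  | 0, q, _ => f q
  | k + 1, q, w =>
    fderiv ℝ (fun q' => covDerivFun nabla f k q' (Fin.tail w)) q (w 0)
      - ∑ i : Fin k, covDerivFun nabla f k q
          (Function.update (Fin.tail w) i (nabla (fun _ => w 0) (fun _ => Fin.tail w i) q))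

/-- The `k`-th covariant derivative `(∇ᵏ X)(w₀, …, w_{k-1})` at a point of a vector field `X`. -/
def covDerivField (nabla : (F → F) → (F → F) → F → F) (X : F → F) :
    ∀ k : ℕ, F → (Fin k → F) → F
  | 0, q, _ => X q
  | k + 1, q, w =>
    nabla (fun _ => w 0) (fun q' => covDerivField nabla X k q' (Fin.tail w)) q
      - ∑ i : Fin k, covDerivField nabla X k q
          (Function.update (Fin.tail w) i (nabla (fun _ => w 0) (fun _ => Fin.tail w i) q))

/-- For the canonical connection, covariant derivatives are ordinary Fréchet derivatives. -/
theorem covDerivFun_canonical {f : F → G} (hf : ContDiff ℝ (⊤ : ℕ∞) f) (k : ℕ) (q : F)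
    (w : Fin k → F) :
    covDerivFun canonicalConnection f k q w = iteratedFDeriv ℝ k f q w := by
  induction k generalizing q with
  | zero => simp [covDerivFun]
  | succ k ih =>
    have hd : DifferentiableAt ℝ (iteratedFDeriv ℝ k f) q :=
      (hf.differentiable_iteratedFDeriv (m := k) (by exact_mod_cast WithTop.coe_lt_top _)) q
    simp only [covDerivFun, ih, canonicalConnection, fderiv_fun_const, Pi.zero_apply,
      zero_apply]
    rw [Finset.sum_eq_zero fun i _ => (iteratedFDeriv ℝ k f q).map_coord_zero i (by simp),
      sub_zero, iteratedFDeriv_succ_apply_left]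
    exact fderiv_continuousMultilinear_apply_const_apply hd _ _

/-- The same for vector fields. -/
theorem covDerivField_canonical {X : F → F} (hX : ContDiff ℝ (⊤ : ℕ∞) X) (k : ℕ) (q : F)
    (w : Fin k → F) :
    covDerivField canonicalConnection X k q w = iteratedFDeriv ℝ k X q w := by
  rw [← covDerivFun_canonical hX]
  induction k generalizing q with
  | zero => rfl
  | succ k ih => simp only [covDerivFun, covDerivField, ih]; rfl

namespace RTree

open Classical in
/-- The vector at the point `q` that is associated with the vertex `v` of the tree `τ` with labels
`e`: the covariant derivative of the vector field `V (e v)`, of order the number of children of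
`v`, applied to the vectors of the children. -/
def vertexVal (nabla : (F → F) → (F → F) → F → F) (V : E → F → F) (q : F) {n : ℕ}
    (τ : RTree (Fin n)) (e : Fin n → E) (v : Fin n) : F :=
  covDerivField nabla (V (e v)) (τ.children v).card q fun j =>
    vertexVal nabla V q τ e ((τ.children v).orderEmbOfFin rfl j)
termination_by (Finset.univ.filter fun w => τ.lt v w).card
decreasing_by
  have hc := (mem_children.1 ((τ.children v).orderEmbOfFin_mem rfl j)).1
  refine Finset.card_lt_card ⟨fun w hw => ?_, fun hsub => ?_⟩
  · have hw := (Finset.mem_filter.1 hw).2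
    refine Finset.mem_filter.2 ⟨Finset.mem_univ _, τ.le_trans _ _ _ hc.1 hw.1, ?_⟩
    rintro rfl
    exact hc.2 (τ.le_antisymm _ _ hc.1 hw.1)
  · exact (Finset.mem_filter.1 (hsub (Finset.mem_filter.2 ⟨Finset.mem_univ _, hc⟩))).2.2 rfl

/-- The value of `Ψ` on the tree `τ` with vertices labelled by `e`: the root corresponds to `f`, and
the vertex `v` to the vector field `V (e v)`. -/
def treeVal (nabla : (F → F) → (F → F) → F → F) (V : E → F → F) (f : F → G) (q : F) {n : ℕ}
    (τ : RTree (Fin n)) (e : Fin n → E) : G :=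
  covDerivFun nabla f τ.roots.card q fun j =>
    τ.vertexVal nabla V q e (τ.roots.orderEmbOfFin rfl j)

end RTree

open Classical in
/-- The (unique, see `CPow.ext_pureC`) continuous linear map on the completed tensor power with
prescribed values on elementary tensors, if there is one. -/
def extendMultilinear {n : ℕ} (B : (Fin n → E) → G) : CPow ν n →L[ℝ] G :=
  if h : ∃ L : CPow ν n →L[ℝ] G, ∀ e, L (pureC ν e) = B e then h.choose else 0

theorem extendMultilinear_eq {n : ℕ} {B : (Fin n → E) → G} {L : CPow ν n →L[ℝ] G}
    (h : ∀ e, L (pureC ν e) = B e) : extendMultilinear ν B = L := by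
  have hex : ∃ L : CPow ν n →L[ℝ] G, ∀ e, L (pureC ν e) = B e := ⟨L, h⟩
  rw [extendMultilinear, dif_pos hex]
  exact CPow.ext_pureC ν fun e => (hex.choose_spec e).trans (h e).symm

/-- The linear map `Ψ` on the tree algebra truncated at degree `N`, for the vector fields `V`, the
function `f`, the base point `q` and the connection `nabla`. -/
def elemDiff (N : ℕ) (nabla : (F → F) → (F → F) → F → F) (V : E → F → F) (f : F → G) (q : F)
    (x : TreeAlg ν) : G :=
  ∑ k ∈ Finset.range (N + 1), ∑ τ : RTree (Fin k),
    extendMultilinear ν (τ.treeVal nabla V f q) ((x k : RawTree ν k) τ)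

/-- The path `y` solves `dy = V(y) dx` on `[0, T]` with respect to the connection `nabla`. -/
def SolvesRDE (p T : ℝ) (ω : ℝ → ℝ → ℝ) (x : ℝ → ℝ → TreeAlg ν)
    (nabla : (F → F) → (F → F) → F → F) (V : E → F → F) (y : ℝ → F) : Prop :=
  ∃ θ : ℝ → ℝ, θ =o[𝓝 0] (fun h : ℝ => h) ∧ ∀ s t, 0 ≤ s → s ≤ t → t ≤ T →
    ‖y t - elemDiff ν ⌊p⌋₊ nabla V id (y s) (x s t)‖ ≤ θ (ω s t)

end

/-! Write Ψ_f(g) for the elementary differential at q with the root read as f, for the canonical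
connection. Covariant derivatives are natural under diffeomorphisms, so the pushed-forward
elementary differential of the identity at φ(q) is Ψ_φ at q (`elemDiff_pushforward`). What remains
is a local change of variables: φ(Ψ_id(g)) = Ψ_φ(g) + O(h^(N+1)) for truncations of group-like g
whose part of degree k ≥ 1 has norm at most h^k (`exists_elemDiff_pushforward_bound`).

This is Taylor's formula. Let z_n be the contribution to Ψ_id(g) of the trees of degree n whose root
has one child (`primitivePart`), and z the sum of the z_n with n ≤ N. The identity has no higher
derivatives, so Ψ_id(g) = q + z. Pair Δg = g ⊗ g with a symmetric (k+1)-linear map, keeping one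
branch of the root in the first factor: every tree whose root has k+1 children is counted k+1 times
(`sum_antidiagonal_forestSum`). By induction on k, trees whose root has k children contribute
D^kφ(q)[z,…,z]/k! to Ψ_φ(g), up to terms of degree above N (`factorial_smul_forestSum`). The sum
over k is the Taylor polynomial of φ at q in the direction z.

All constants are uniform over the compact image of y; for the derivatives of V_e, uniformity in e
comes from Banach–Steinhaus. With h = ω^(1/p) the error is of order ω^((N+1)/p), which is o(ω)
because N + 1 > p. As φ and its inverse are Lipschitz near the compact images of the two paths, the
solution estimate transfers in both directions. -/

open scoped TensorProduct Topology

noncomputable section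

variable {E : Type*} [NormedAddCommGroup E] [NormedSpace ℝ E] (ν : SymmCrossNorm E)
variable {F G : Type*} [NormedAddCommGroup F] [NormedSpace ℝ F]
  [NormedAddCommGroup G] [NormedSpace ℝ G]

/-! ### Combinatorics of rooted trees -/

namespace RTree

section Combinatorics

variable {ι κ : Type} [Fintype ι] [Fintype κ]

theorem mem_roots {τ : RTree ι} {v : ι} : v ∈ τ.roots ↔ ∀ w, ¬ τ.lt w v := by
  classical
  simp [roots]

omit [Fintype ι] in
theorem lt_trans_le {τ : RTree ι} {a b c : ι} (h : τ.lt a b) (h' : τ.le b c) : τ.lt a c := by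
  refine ⟨τ.le_trans _ _ _ h.1 h', ?_⟩
  rintro rfl
  exact h.2 (τ.le_antisymm _ _ h.1 h')

/-- Allows induction from the leaves towards the root, the direction in which `vertexVal` recurses.
-/
theorem wellFounded_gt (τ : RTree ι) : WellFounded fun a b => τ.lt b a := by
  have : IsTrans ι fun a b => τ.lt b a := ⟨fun _ _ _ h h' => lt_trans_le h' h.1⟩
  have : Std.Irrefl fun a b => τ.lt b a := ⟨fun _ h => h.2 rfl⟩
  exact Finite.wellFounded_of_trans_of_irrefl _

theorem wellFounded_lt (τ : RTree ι) : WellFounded τ.lt := by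
  have : IsTrans ι τ.lt := ⟨fun _ _ _ h h' => lt_trans_le h h'.1⟩
  have : Std.Irrefl τ.lt := ⟨fun _ h => h.2 rfl⟩
  exact Finite.wellFounded_of_trans_of_irrefl _

/-- Together with `root_unique`, this says that the branches of the root partition the vertices;
`exists_child_le` and `child_unique` do the same above a given vertex. -/
theorem exists_root_le (τ : RTree ι) (u : ι) : ∃ r ∈ τ.roots, τ.le r u := by
  obtain ⟨r, hr, hmin⟩ := τ.wellFounded_lt.has_min {w | τ.le w u} ⟨u, τ.le_refl u⟩
  exact ⟨r, mem_roots.2 fun w hw => hmin w (τ.le_trans _ _ _ hw.1 hr) hw, hr⟩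

theorem root_unique {τ : RTree ι} {r r' u : ι} (hr : r ∈ τ.roots) (hr' : r' ∈ τ.roots)
    (h : τ.le r u) (h' : τ.le r' u) : r = r' :=
  eq_of_mem_roots hr' (le_of_mem_roots hr h h')

theorem exists_child_le {τ : RTree ι} {v u : ι} (h : τ.lt v u) :
    ∃ w ∈ τ.children v, τ.le w u := by
  obtain ⟨r, hr, hmin⟩ := τ.wellFounded_lt.has_min {w | τ.lt v w ∧ τ.le w u} ⟨u, h, τ.le_refl u⟩
  exact ⟨r, mem_children.2 ⟨hr.1, fun w hw => hmin w ⟨hw.1, τ.le_trans _ _ _ hw.2.1 hr.2⟩ hw.2⟩,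
    hr.2⟩

theorem child_unique {τ : RTree ι} {v w w' u : ι} (hw : w ∈ τ.children v)
    (hw' : w' ∈ τ.children v) (h : τ.le w u) (h' : τ.le w' u) : w = w' := by
  rw [mem_children] at hw hw'
  by_contra hne
  rcases τ.chain _ _ _ h h' with h₁ | h₁
  · exact hw'.2 w ⟨hw.1, h₁, hne⟩
  · exact hw.2 w' ⟨hw'.1, h₁, fun e => hne e.symm⟩

theorem card_children_lt (τ : RTree ι) (v : ι) : (τ.children v).card < Fintype.card ι := by
  refine Finset.card_lt_univ_of_notMem (x := v) fun h => ?_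
  exact (mem_children.1 h).1.2 rfl

/-- A set of vertices, given as the range of a map, is closed under passing to higher vertices. -/
def UpClosed (τ : RTree ι) (f : κ → ι) : Prop := ∀ a w, τ.le (f a) w → w ∈ Set.range f

omit [Fintype ι] [Fintype κ] in
theorem lt_comap {τ : RTree ι} {f : κ ↪ ι} {a b : κ} : (τ.comap f).lt a b ↔ τ.lt (f a) (f b) := by
  simp [lt, comap]

theorem mem_children_of_upClosed {τ : RTree ι} {f : κ ↪ ι} (hf : τ.UpClosed f) (a : κ) (w : ι) :
    w ∈ τ.children (f a) ↔ ∃ b ∈ (τ.comap f).children a, f b = w := by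
  simp only [mem_children, lt_comap]
  constructor
  · rintro ⟨h, h'⟩
    obtain ⟨b, rfl⟩ := hf a w h.1
    exact ⟨b, ⟨h, fun u => h' (f u)⟩, rfl⟩
  · rintro ⟨b, ⟨h, h'⟩, rfl⟩
    refine ⟨h, fun u hu => ?_⟩
    obtain ⟨c, rfl⟩ := hf a u hu.1.1
    exact h' c hu

/-- Nothing in the range of `g` can lie below a point in the range of `f`, so minimality may be
tested inside the range of `f`. -/
theorem mem_roots_iff_of_upClosed {τ : RTree ι} {κ₂ : Type} [Fintype κ₂] {f : κ ↪ ι}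
    {g : κ₂ ↪ ι} (hg : τ.UpClosed g) (hcov : ∀ w, w ∈ Set.range f ∨ w ∈ Set.range g)
    (hdis : ∀ a b, f a ≠ g b) (a : κ) :
    f a ∈ τ.roots ↔ a ∈ (τ.comap f).roots := by
  simp only [mem_roots, lt_comap]
  refine ⟨fun h w => h _, fun h w hw => ?_⟩
  rcases hcov w with ⟨c, rfl⟩ | ⟨c, rfl⟩
  · exact h c hw
  · obtain ⟨b, hb⟩ := hg c _ hw.1
    exact hdis a b hb.symm

theorem upClosed_of_mem_branches {τ : RTree ι} {I : Finset ι} {v w : ι}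
    (hv : v ∈ τ.branches I) (h : τ.le v w) : w ∈ τ.branches I := by
  classical
  simp only [branches, Finset.mem_filter, Finset.mem_univ, true_and] at hv ⊢
  obtain ⟨r, hr, hrv⟩ := hv
  exact ⟨r, hr, τ.le_trans _ _ _ hrv h⟩

theorem mem_branches_of_le {τ : RTree ι} {I : Finset ι} (hI : I ⊆ τ.roots) {v w : ι}
    (hw : w ∈ τ.branches I) (h : τ.le v w) : v ∈ τ.branches I := by
  classical
  simp only [branches, Finset.mem_filter, Finset.mem_univ, true_and] at hw ⊢
  obtain ⟨r, hr, hrv⟩ := hw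
  exact ⟨r, hr, le_of_mem_roots (hI hr) hrv h⟩

end Combinatorics

end RTree

/-! ### Independence of the enumeration of a finite set of vertices -/

theorem Finset.exists_perm_orderEmbOfFin {n k : ℕ} (s : Finset (Fin n)) (h : s.card = k)
    (u : Fin k → Fin n) (hu : Function.Injective u) (hs : ∀ w, w ∈ s ↔ w ∈ Set.range u) :
    ∃ σ : Equiv.Perm (Fin k), ∀ j, u j = s.orderEmbOfFin h (σ j) := by
  let u' : Fin k ≃ s := Equiv.ofBijective (fun j => ⟨u j, (hs _).2 ⟨j, rfl⟩⟩)
    ⟨fun a b hab => hu (congrArg Subtype.val hab), fun w => by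
      obtain ⟨j, hj⟩ := (hs _).1 w.2
      exact ⟨j, Subtype.ext hj⟩⟩
  refine ⟨u'.trans (s.orderIsoOfFin h).symm.toEquiv, fun j => ?_⟩
  rw [← Finset.coe_orderIsoOfFin_apply]
  change u j = (s.orderIsoOfFin h ((s.orderIsoOfFin h).symm (u' j)) : Fin n)
  rw [OrderIso.apply_symm_apply]
  rfl

theorem Finset.prod_orderEmbOfFin {M : Type*} [CommMonoid M] {n k : ℕ} (s : Finset (Fin n))
    (h : s.card = k) (f : Fin n → M) : ∏ j, f (s.orderEmbOfFin h j) = ∏ w ∈ s, f w := by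
  rw [← Finset.prod_coe_sort s f]
  exact Fintype.prod_equiv (s.orderIsoOfFin h).toEquiv _ _ fun j => by
    rw [← Finset.coe_orderIsoOfFin_apply]; rfl

/-! ### Elementary differentials for the canonical connection -/

/-- Symmetric multilinear maps. -/
def ContinuousMultilinearMap.IsSymm {k : ℕ} (A : F [×k]→L[ℝ] G) : Prop :=
  ∀ (σ : Equiv.Perm (Fin k)) (w : Fin k → F), A (fun j => w (σ j)) = A w

/-- The permutations that leave `A` invariant form a submonoid, and adjacent transpositions generate
the whole permutation group. -/
theorem ContinuousMultilinearMap.IsSymm.of_swap {k : ℕ} {A : F [×(k + 1)]→L[ℝ] G}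
    (h : ∀ (i : Fin k) (w : Fin (k + 1) → F),
      A (fun j => w (Equiv.swap i.castSucc i.succ j)) = A w) : A.IsSymm := by
  let S : Submonoid (Equiv.Perm (Fin (k + 1))) :=
    { carrier := {σ | ∀ w : Fin (k + 1) → F, A (fun j => w (σ j)) = A w}
      one_mem' := fun w => rfl
      mul_mem' := fun {σ τ} hσ hτ w => (hτ fun j => w (σ j)).trans (hσ w) }
  have hS : S = ⊤ := by
    rw [← top_le_iff, ← Equiv.Perm.mclosure_swap_castSucc_succ, Submonoid.closure_le]
    rintro _ ⟨i, rfl⟩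
    exact h i
  intro σ
  have : σ ∈ S := hS ▸ Submonoid.mem_top σ
  exact this

theorem ContinuousMultilinearMap.IsSymm.curryLeft {k : ℕ} {A : F [×(k + 1)]→L[ℝ] G}
    (hA : A.IsSymm) (u : F) : (A.curryLeft u).IsSymm := by
  intro σ w
  rw [ContinuousMultilinearMap.curryLeft_apply, ContinuousMultilinearMap.curryLeft_apply,
    -- This permutation fixes the first slot and acts by `σ` on the others.
    ← hA (Equiv.Perm.decomposeFin.symm (0, σ)) (Fin.cons u w)]
  congr 1
  funext j
  refine Fin.cases ?_ (fun i => ?_) j <;> simp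

/-- By adjacent transpositions: exchanging the first two arguments is the symmetry of the second
derivative of a lower iterated derivative. Every other adjacent swap fixes the first argument and is
inherited from the derivative of one order less. -/
theorem ContDiffAt.isSymm_iteratedFDeriv_nat (f : F → G) (k : ℕ) :
    ∀ q, ContDiffAt ℝ k f q → (iteratedFDeriv ℝ k f q).IsSymm := by
  induction k with
  | zero => exact fun q _ σ w => by congr 1; exact Subsingleton.elim _ _
  | succ k ih =>
    intro q hf
    refine ContinuousMultilinearMap.IsSymm.of_swap fun i w => ?_
    have hd : ∀ p, ContDiffAt ℝ (k + 1 : ℕ) f p →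
        DifferentiableAt ℝ (iteratedFDeriv ℝ k f) p := fun p hp =>
      (hp.iteratedFDeriv_right (m := 1) (i := k) (by
        rw [add_comm]; exact_mod_cast le_rfl)).differentiableAt one_ne_zero
    cases k with
    | zero => exact i.elim0
    | succ k =>
      refine Fin.cases ?_ (fun i => ?_) i
      · have hsymm : IsSymmSndFDerivAt ℝ (iteratedFDeriv ℝ k f) q :=
          (hf.iteratedFDeriv_right (m := 2) (i := k) (by
            rw [add_comm]; exact_mod_cast le_rfl)).isSymmSndFDerivAt (by simp)
        have key : ∀ v : Fin (k + 1 + 1) → F, iteratedFDeriv ℝ (k + 1 + 1) f q v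
            = fderiv ℝ (fderiv ℝ (iteratedFDeriv ℝ k f)) q (v 0) (v 1)
              (Fin.tail (Fin.tail v)) := by
          intro v
          have hdd : DifferentiableAt ℝ (fderiv ℝ (iteratedFDeriv ℝ k f)) q :=
            ((hf.iteratedFDeriv_right (m := 2) (i := k) (by
              rw [add_comm]; exact_mod_cast le_rfl)).fderiv_right (m := 1)
              (by norm_num)).differentiableAt one_ne_zero
          rw [iteratedFDeriv_succ_apply_left,
            ← fderiv_continuousMultilinear_apply_const_apply (hd q hf)]
          simp only [iteratedFDeriv_succ_apply_left]
          have h := ((hdd.hasFDerivAt.clm_apply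
            (hasFDerivAt_const (Fin.tail v 0) q)).continuousMultilinear_apply_const
              (Fin.tail (Fin.tail v))).fderiv
          rw [h]
          simp [Fin.tail]
        rw [key, key]
        simp only [Fin.castSucc_zero, Fin.succ_zero_eq_one, Equiv.swap_apply_left,
          Equiv.swap_apply_right]
        rw [hsymm.eq]
        congr 1
      · rw [iteratedFDeriv_succ_apply_left, iteratedFDeriv_succ_apply_left]
        have h0 : Equiv.swap i.succ.castSucc i.succ.succ 0 = 0 :=
          Equiv.swap_apply_of_ne_of_ne (by simp [Fin.ext_iff]) (by simp [Fin.ext_iff])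
        have ht : (Fin.tail fun j => w (Equiv.swap i.succ.castSucc i.succ.succ j))
            = fun j => Fin.tail w (Equiv.swap i.castSucc i.succ j) := by
          funext j
          simp only [Fin.tail]
          congr 1
          rw [← Fin.succ_castSucc, ← (Fin.succ_injective _).swap_apply]
        rw [ht, h0, ← fderiv_continuousMultilinear_apply_const_apply (hd q hf),
          ← fderiv_continuousMultilinear_apply_const_apply (hd q hf)]
        congr 1
        -- The lower-order symmetry has to hold in a neighbourhood of `q` before it can be
        -- differentiated.
        refine Filter.EventuallyEq.fderiv_eq ?_
        filter_upwards [hf.eventually (by simp)] with p hp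
        exact ih p (hp.of_le (by exact_mod_cast Nat.le_succ _)) _ _

theorem ContDiffAt.isSymm_iteratedFDeriv {f : F → G} {q : F}
    (hf : ContDiffAt ℝ (⊤ : ℕ∞) f q) (k : ℕ) : (iteratedFDeriv ℝ k f q).IsSymm :=
  ContDiffAt.isSymm_iteratedFDeriv_nat f k q (hf.of_le (by exact_mod_cast le_top))

namespace RTree

/-- The vector of a vertex for the canonical connection. -/
abbrev canonVal (V : E → F → F) (q : F) {n : ℕ} (τ : RTree (Fin n)) (e : Fin n → E)
    (v : Fin n) : F :=
  τ.vertexVal canonicalConnection V q e v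

open Classical in
/-- The value of a `k`-linear map on the vectors of the children of the root, on trees whose root
has `k` children. -/
def forestVal (V : E → F → F) (q : F) {k : ℕ} (A : F [×k]→L[ℝ] G) {n : ℕ} (τ : RTree (Fin n))
    (e : Fin n → E) : G :=
  if h : τ.roots.card = k then A fun j => τ.canonVal V q e (τ.roots.orderEmbOfFin h j) else 0

variable {V : E → F → F} (hV : ∀ e, ContDiff ℝ (⊤ : ℕ∞) (V e)) {q : F}
  {n m l k : ℕ} {τ : RTree (Fin n)}

omit [NormedAddCommGroup E] [NormedSpace ℝ E] in
include hV in
theorem canonVal_eq_orderEmb (e : Fin n → E) (v : Fin n) :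
    τ.canonVal V q e v = iteratedFDeriv ℝ (τ.children v).card (V (e v)) q
      fun j => τ.canonVal V q e ((τ.children v).orderEmbOfFin rfl j) := by
  rw [canonVal, vertexVal, covDerivField_canonical (hV _)]

omit [NormedAddCommGroup E] [NormedSpace ℝ E] in
include hV in
-- The definition lists children in increasing order; symmetry of the derivative allows any other
-- enumeration, as is needed once vertices are relabelled.
theorem canonVal_eq (e : Fin n → E) (v : Fin n) (u : Fin k → Fin n) (hu : Function.Injective u)
    (h : ∀ w, w ∈ τ.children v ↔ w ∈ Set.range u) :
    τ.canonVal V q e v = iteratedFDeriv ℝ k (V (e v)) q fun j => τ.canonVal V q e (u j) := by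
  classical
  have hk : (τ.children v).card = k := by
    rw [show τ.children v = Finset.univ.image u by ext w; simp [h w],
      Finset.card_image_of_injective _ hu, Finset.card_univ, Fintype.card_fin]
  subst hk
  obtain ⟨σ, hσ⟩ := Finset.exists_perm_orderEmbOfFin _ rfl u hu h
  simp only [hσ]
  rw [(hV _).contDiffAt.isSymm_iteratedFDeriv _ σ
    (fun j => τ.canonVal V q e ((τ.children v).orderEmbOfFin rfl j)), ← canonVal_eq_orderEmb hV]

omit [NormedAddCommGroup E] [NormedSpace ℝ E] in
theorem forestVal_eq {A : F [×k]→L[ℝ] G} (hA : A.IsSymm) (e : Fin n → E) (u : Fin k → Fin n)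
    (hu : Function.Injective u) (h : ∀ w, w ∈ τ.roots ↔ w ∈ Set.range u) :
    τ.forestVal V q A e = A fun j => τ.canonVal V q e (u j) := by
  classical
  have hk : τ.roots.card = k := by
    rw [show τ.roots = Finset.univ.image u by ext w; simp [h w],
      Finset.card_image_of_injective _ hu, Finset.card_univ, Fintype.card_fin]
  obtain ⟨σ, hσ⟩ := Finset.exists_perm_orderEmbOfFin _ hk u hu h
  simp only [hσ]
  rw [hA σ (fun j => τ.canonVal V q e (τ.roots.orderEmbOfFin hk j)), forestVal, dif_pos hk]

omit [NormedAddCommGroup E] [NormedSpace ℝ E] in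
include hV in
/-- Elementary differentials of a vertex only depend on the part of the tree above the vertex. -/
theorem canonVal_comap {f : Fin m ↪ Fin n} (hf : τ.UpClosed f) (e : Fin n → E) (a : Fin m) :
    τ.canonVal V q e (f a) = (τ.comap f).canonVal V q (fun i => e (f i)) a := by
  refine (τ.comap f).wellFounded_gt.induction
    (C := fun a => τ.canonVal V q e (f a) = (τ.comap f).canonVal V q (fun i => e (f i)) a) a ?_
  intro a ih
  rw [canonVal_eq_orderEmb hV (τ := τ.comap f), canonVal_eq hV e (f a)
    (fun j => f (((τ.comap f).children a).orderEmbOfFin rfl j))]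
  · congr 1
    funext j
    exact ih _ (mem_children.1 (((τ.comap f).children a).orderEmbOfFin_mem rfl j)).1
  · exact f.injective.comp (Finset.orderEmbOfFin _ _).injective
  · intro w
    rw [mem_children_of_upClosed hf]
    constructor
    · rintro ⟨b, hb, rfl⟩
      have hb' : b ∈ Set.range (((τ.comap f).children a).orderEmbOfFin rfl) := by
        rw [Finset.range_orderEmbOfFin]; exact hb
      obtain ⟨j, rfl⟩ := hb'
      exact ⟨j, rfl⟩
    · rintro ⟨j, rfl⟩
      exact ⟨_, Finset.orderEmbOfFin_mem _ _ _, rfl⟩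

/-- The identity as a `1`-linear map. -/
def idOne : F [×1]→L[ℝ] F :=
  ContinuousMultilinearMap.ofSubsingleton ℝ F F (0 : Fin 1) (ContinuousLinearMap.id ℝ F)

theorem idOne_apply (w : Fin 1 → F) : idOne w = w 0 := by
  simp [idOne]

omit [NormedAddCommGroup E] [NormedSpace ℝ E] in
include hV in
/-- Elementary differentials of a tree that is split into one branch of the root and the rest. -/
theorem forestVal_split {f : Fin m ↪ Fin n} {g : Fin l ↪ Fin n} (hf : τ.UpClosed f)
    (hg : τ.UpClosed g) (hcov : ∀ w, w ∈ Set.range f ∨ w ∈ Set.range g)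
    (hdis : ∀ a b, f a ≠ g b) (hone : (τ.comap f).roots.card = 1)
    {A : F [×(k + 1)]→L[ℝ] G} (hA : A.IsSymm) (e : Fin n → E) :
    τ.forestVal V q A e = (τ.comap g).forestVal V q
      (A.curryLeft ((τ.comap f).forestVal V q idOne fun i => e (f i))) fun i => e (g i) := by
  classical
  obtain ⟨r, hr⟩ := Finset.card_eq_one.1 hone
  have hroots : ∀ w, w ∈ τ.roots ↔ w = f r ∨ ∃ b ∈ (τ.comap g).roots, g b = w := by
    have hrf := mem_roots_iff_of_upClosed hg hcov hdis
    have hrg := mem_roots_iff_of_upClosed hf (fun w => (hcov w).symm)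
      (fun a b h => hdis b a h.symm)
    intro w
    rcases hcov w with ⟨c, rfl⟩ | ⟨c, rfl⟩
    · rw [hrf, hr, Finset.mem_singleton, f.injective.eq_iff]
      exact ⟨Or.inl, fun h => h.elim id fun ⟨b, _, hb⟩ => (hdis c b hb.symm).elim⟩
    · rw [hrg]
      refine ⟨fun h => Or.inr ⟨c, h, rfl⟩, ?_⟩
      rintro (h | ⟨b, hb, h⟩)
      · exact (hdis _ _ h.symm).elim
      · rwa [← g.injective h]
  have hroots' : τ.roots = insert (f r) ((τ.comap g).roots.map g) := by
    ext w
    simp [hroots w]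
  have hcard : τ.roots.card = (τ.comap g).roots.card + 1 := by
    rw [hroots', Finset.card_insert_of_notMem, Finset.card_map]
    simp only [Finset.mem_map, not_exists, not_and]
    exact fun b _ hb => hdis r b hb.symm
  by_cases hk : (τ.comap g).roots.card = k
  · rw [forestVal_eq hA e
      (Fin.cons (f r) fun j => g ((τ.comap g).roots.orderEmbOfFin hk j) : Fin (k + 1) → Fin n)]
    · rw [forestVal, dif_pos hk, ContinuousMultilinearMap.curryLeft_apply]
      congr 1
      funext j
      refine Fin.cases ?_ (fun i => ?_) j
      · simp only [Fin.cons_zero]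
        rw [forestVal, dif_pos hone, idOne_apply, canonVal_comap hV hf]
        congr 1
        have := (τ.comap f).roots.orderEmbOfFin_mem hone 0
        exact (Finset.mem_singleton.1 (hr ▸ this)).symm
      · simp only [Fin.cons_succ]
        rw [canonVal_comap hV hg]
    · rw [Fin.cons_injective_iff]
      refine ⟨?_, g.injective.comp (Finset.orderEmbOfFin _ _).injective⟩
      rintro ⟨j, hj⟩
      exact hdis _ _ hj.symm
    · intro w
      rw [hroots, Fin.range_cons, Set.mem_insert_iff]
      refine or_congr Iff.rfl ⟨?_, ?_⟩
      · rintro ⟨b, hb, rfl⟩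
        have hb' : b ∈ Set.range ((τ.comap g).roots.orderEmbOfFin hk) := by
          rw [Finset.range_orderEmbOfFin]; exact hb
        obtain ⟨j, rfl⟩ := hb'
        exact ⟨j, rfl⟩
      · rintro ⟨j, rfl⟩
        exact ⟨_, Finset.orderEmbOfFin_mem _ _ _, rfl⟩
  · rw [forestVal, dif_neg (by omega), forestVal, dif_neg hk]

/-! ### Multilinearity and norm bounds in the labels -/

omit [NormedAddCommGroup E] [NormedSpace ℝ E] in
include hV in
-- The vector of a vertex only involves the labels of the vertices weakly above it.
theorem canonVal_update_of_not_le (e : Fin n → E) (i : Fin n) (c : E) (v : Fin n) :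
    ¬ τ.le v i → τ.canonVal V q (Function.update e i c) v = τ.canonVal V q e v := by
  refine τ.wellFounded_gt.induction (C := fun v => ¬ τ.le v i →
    τ.canonVal V q (Function.update e i c) v = τ.canonVal V q e v) v ?_
  intro v ih hv
  rw [canonVal_eq_orderEmb hV, canonVal_eq_orderEmb hV, Function.update_of_ne]
  · congr 1
    funext j
    have hj := (mem_children.1 ((τ.children v).orderEmbOfFin_mem rfl j)).1
    exact ih _ hj fun h => hv (τ.le_trans _ _ _ hj.1 h)
  · rintro rfl
    exact hv (τ.le_refl _)

theorem _root_.ContinuousMultilinearMap.isLinearMap_update {E' : Type*} [AddCommGroup E']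
    [Module ℝ E'] (A : F [×k]→L[ℝ] G)
    {w : E' → Fin k → F} (w₀ : Fin k → F) (j : Fin k) (hj : IsLinearMap ℝ fun c => w c j)
    (hne : ∀ c i, i ≠ j → w c i = w₀ i) : IsLinearMap ℝ fun c => A (w c) := by
  have hw : ∀ c, w c = Function.update w₀ j (w c j) := fun c => by
    funext i
    by_cases h : i = j
    · subst h; simp
    · rw [Function.update_of_ne h, hne c i h]
  refine ⟨fun c c' => ?_, fun r c => ?_⟩
  · show A (w (c + c')) = A (w c) + A (w c')
    rw [hw (c + c'), hj.map_add, A.map_update_add, ← hw, ← hw]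
  · show A (w (r • c)) = r • A (w c)
    rw [hw (r • c), hj.map_smul, A.map_update_smul, ← hw]

include hV in
-- If `v = i`, the label enters only through the field at `v`, linearly by `hlin`. Otherwise exactly
-- one child of `v` lies weakly below `i`, so the label enters a single slot of a multilinear map.
theorem isLinearMap_canonVal
    (hlin : ∀ (k : ℕ) (w : Fin k → F), IsLinearMap ℝ fun e => iteratedFDeriv ℝ k (V e) q w)
    (e : Fin n → E) (i v : Fin n) :
    τ.le v i → IsLinearMap ℝ fun c => τ.canonVal V q (Function.update e i c) v := by
  refine τ.wellFounded_gt.induction (C := fun v => τ.le v i →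
    IsLinearMap ℝ fun c => τ.canonVal V q (Function.update e i c) v) v ?_
  intro v ih hv
  by_cases hvi : v = i
  · subst hvi
    convert hlin (τ.children v).card
      (fun j => τ.canonVal V q e ((τ.children v).orderEmbOfFin rfl j)) using 2 with c
    rw [canonVal_eq_orderEmb hV, Function.update_self]
    congr 1
    funext j
    have hj := (mem_children.1 ((τ.children v).orderEmbOfFin_mem rfl j)).1
    exact canonVal_update_of_not_le hV _ _ _ _ fun h => hj.2 (τ.le_antisymm _ _ hj.1 h)
  · obtain ⟨w, hw, hwi⟩ := exists_child_le (τ := τ) ⟨hv, hvi⟩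
    obtain ⟨j, rfl⟩ : w ∈ Set.range ((τ.children v).orderEmbOfFin rfl) := by
      rw [Finset.range_orderEmbOfFin]; exact hw
    have := ContinuousMultilinearMap.isLinearMap_update
      (iteratedFDeriv ℝ (τ.children v).card (V (e v)) q)
      (w := fun c j => τ.canonVal V q (Function.update e i c)
        ((τ.children v).orderEmbOfFin rfl j))
      (fun j => τ.canonVal V q e ((τ.children v).orderEmbOfFin rfl j)) j
      (ih _ (mem_children.1 hw).1 hwi) (fun c j' hj' => ?_)
    · convert this using 2 with c
      rw [canonVal_eq_orderEmb hV, Function.update_of_ne hvi]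
    · refine canonVal_update_of_not_le hV _ _ _ _ fun h => hj' ?_
      exact ((τ.children v).orderEmbOfFin rfl).injective
        (child_unique (Finset.orderEmbOfFin_mem _ _ _) hw h hwi)

include hV in
theorem isLinearMap_forestVal
    (hlin : ∀ (k : ℕ) (w : Fin k → F), IsLinearMap ℝ fun e => iteratedFDeriv ℝ k (V e) q w)
    (A : F [×k]→L[ℝ] G) (e : Fin n → E) (i : Fin n) :
    IsLinearMap ℝ fun c => τ.forestVal V q A (Function.update e i c) := by
  unfold forestVal
  split_ifs with hk
  · obtain ⟨w, hw, hwi⟩ := τ.exists_root_le i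
    obtain ⟨j, rfl⟩ : w ∈ Set.range (τ.roots.orderEmbOfFin hk) := by
      rw [Finset.range_orderEmbOfFin]; exact hw
    refine A.isLinearMap_update (fun j => τ.canonVal V q e (τ.roots.orderEmbOfFin hk j)) j
      (isLinearMap_canonVal hV hlin _ _ _ hwi) fun c j' hj' => ?_
    refine canonVal_update_of_not_le hV _ _ _ _ fun h => hj' ?_
    exact (τ.roots.orderEmbOfFin hk).injective
      (root_unique (Finset.orderEmbOfFin_mem _ _ _) hw h hwi)
  · exact ⟨fun _ _ => by simp, fun _ _ => by simp⟩

open Classical in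
omit [NormedSpace ℝ E] in
include hV in
-- Each vertex weakly above `v` contributes one factor `C * ‖e u‖`, because this set is the disjoint
-- union of `v` and the corresponding sets of its children.
theorem norm_canonVal_le {N : ℕ} (hn : n ≤ N) {C : ℝ}
    (hC : ∀ k ≤ N, ∀ e, ‖iteratedFDeriv ℝ k (V e) q‖ ≤ C * ‖e‖) (e : Fin n → E) (v : Fin n) :
    ‖τ.canonVal V q e v‖ ≤ ∏ u ∈ Finset.univ.filter (τ.le v), C * ‖e u‖ := by
  refine τ.wellFounded_gt.induction (C := fun v =>
    ‖τ.canonVal V q e v‖ ≤ ∏ u ∈ Finset.univ.filter (τ.le v), C * ‖e u‖) v ?_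
  intro v ih
  have hset : Finset.univ.filter (τ.le v)
      = insert v ((τ.children v).biUnion fun w => Finset.univ.filter (τ.le w)) := by
    ext u
    simp only [Finset.mem_filter, Finset.mem_univ, true_and, Finset.mem_insert,
      Finset.mem_biUnion]
    constructor
    · intro h
      by_cases hu : u = v
      · exact Or.inl hu
      · exact Or.inr (exists_child_le ⟨h, fun h => hu h.symm⟩)
    · rintro (rfl | ⟨w, hw, h⟩)
      · exact τ.le_refl _
      · exact τ.le_trans _ _ _ (mem_children.1 hw).1.1 h
  rw [hset, Finset.prod_insert, Finset.prod_biUnion, canonVal_eq_orderEmb hV]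
  · refine (ContinuousMultilinearMap.le_opNorm _ _).trans ?_
    have hcard : (τ.children v).card ≤ N := by
      have := τ.card_children_lt v
      rw [Fintype.card_fin] at this
      omega
    refine mul_le_mul (hC _ hcard _) ?_ (by positivity) ((norm_nonneg _).trans (hC _ hcard _))
    rw [← Finset.prod_orderEmbOfFin (τ.children v) rfl]
    exact Finset.prod_le_prod (fun _ _ => norm_nonneg _) fun j _ =>
      ih _ (mem_children.1 ((τ.children v).orderEmbOfFin_mem rfl j)).1
  · intro w hw w' hw' hne
    refine Finset.disjoint_left.2 fun u hu hu' => hne ?_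
    exact child_unique hw hw' (Finset.mem_filter.1 hu).2 (Finset.mem_filter.1 hu').2
  · simp only [Finset.mem_biUnion, Finset.mem_filter, Finset.mem_univ, true_and, not_exists,
      not_and]
    intro w hw h
    exact (mem_children.1 hw).1.2 (τ.le_antisymm _ _ (mem_children.1 hw).1.1 h)

omit [NormedSpace ℝ E] in
include hV in
theorem norm_forestVal_le {N : ℕ} (hn : n ≤ N) {C : ℝ}
    (hC : ∀ k ≤ N, ∀ e, ‖iteratedFDeriv ℝ k (V e) q‖ ≤ C * ‖e‖) (hC0 : 0 ≤ C)
    (A : F [×k]→L[ℝ] G) (e : Fin n → E) :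
    ‖τ.forestVal V q A e‖ ≤ ‖A‖ * C ^ n * ∏ i, ‖e i‖ := by
  classical
  unfold forestVal
  split_ifs with hk
  · refine (A.le_opNorm _).trans ?_
    rw [mul_assoc]
    refine mul_le_mul_of_nonneg_left ?_ (norm_nonneg _)
    have hset : (Finset.univ : Finset (Fin n))
        = τ.roots.biUnion fun w => Finset.univ.filter (τ.le w) := by
      ext u
      simpa using τ.exists_root_le u
    have : C ^ n * ∏ i, ‖e i‖ = ∏ i, C * ‖e i‖ := by simp [Finset.prod_mul_distrib]
    rw [this, hset, Finset.prod_biUnion, ← Finset.prod_orderEmbOfFin τ.roots hk]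
    · exact Finset.prod_le_prod (fun _ _ => norm_nonneg _) fun j _ => norm_canonVal_le hV hn hC _ _
    · intro w hw w' hw' hne
      refine Finset.disjoint_left.2 fun u hu hu' => hne ?_
      exact root_unique hw hw' (Finset.mem_filter.1 hu).2 (Finset.mem_filter.1 hu').2
  · rw [norm_zero]
    positivity

end RTree

/-! ### Naturality of covariant derivatives under diffeomorphisms -/

theorem IsOpen.contDiffAt_of_contDiffOn {f : F → G} {s : Set F} (hs : IsOpen s)
    (hf : ContDiffOn ℝ (⊤ : ℕ∞) f s) {q : F} (hq : q ∈ s) : ContDiffAt ℝ (⊤ : ℕ∞) f q :=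
  hf.contDiffAt (hs.mem_nhds hq)

theorem ContDiffAt.differentiableAt_iteratedFDeriv_top {f : F → G} {q : F}
    (hf : ContDiffAt ℝ (⊤ : ℕ∞) f q) (k : ℕ) : DifferentiableAt ℝ (iteratedFDeriv ℝ k f) q :=
  (hf.iteratedFDeriv_right (m := 1) (i := k)
    (by exact_mod_cast (le_top : ((1 + k : ℕ) : ℕ∞) ≤ ⊤))).differentiableAt one_ne_zero

theorem ContDiffAt.differentiableAt_fderiv_top {f : F → G} {q : F}
    (hf : ContDiffAt ℝ (⊤ : ℕ∞) f q) : DifferentiableAt ℝ (fderiv ℝ f) q :=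
  (hf.fderiv_right (m := 1)
    (WithTop.coe_le_coe.2 le_top)).differentiableAt one_ne_zero

/-- The derivative of an iterated derivative along a map, applied to moving vectors. -/
theorem fderiv_iteratedFDeriv_comp_apply {f : F → G} {ψ : F → F} {q : F} {k : ℕ}
    (hf : ContDiffAt ℝ (⊤ : ℕ∞) f (ψ q)) (hψ : ContDiffAt ℝ (⊤ : ℕ∞) ψ q) (w : Fin (k + 1) → F) :
    DifferentiableAt ℝ
      (fun q' => iteratedFDeriv ℝ k f (ψ q') fun i => fderiv ℝ ψ q' (Fin.tail w i)) q ∧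
    fderiv ℝ (fun q' => iteratedFDeriv ℝ k f (ψ q') fun i => fderiv ℝ ψ q' (Fin.tail w i)) q (w 0)
      = iteratedFDeriv ℝ (k + 1) f (ψ q) (fun i => fderiv ℝ ψ q (w i))
        + ∑ i, iteratedFDeriv ℝ k f (ψ q) (Function.update (fun i => fderiv ℝ ψ q (Fin.tail w i)) i
            (fderiv ℝ (fderiv ℝ ψ) q (w 0) (Fin.tail w i))) := by
  have h₁ : HasFDerivAt (fun q' => iteratedFDeriv ℝ k f (ψ q'))
      (fderiv ℝ (iteratedFDeriv ℝ k f) (ψ q) ∘L fderiv ℝ ψ q) q :=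
    (hf.differentiableAt_iteratedFDeriv_top k).hasFDerivAt.comp q
      (hψ.differentiableAt (by simp)).hasFDerivAt
  have h₂ : ∀ i, HasFDerivAt (fun q' => fderiv ℝ ψ q' (Fin.tail w i))
      ((fderiv ℝ (fderiv ℝ ψ) q).flip (Fin.tail w i)) q := fun i => by
    simpa using hψ.differentiableAt_fderiv_top.hasFDerivAt.clm_apply
      (hasFDerivAt_const (Fin.tail w i) q)
  have h := h₁.continuousMultilinearMap_apply h₂
  refine ⟨h.differentiableAt, ?_⟩
  rw [h.fderiv, iteratedFDeriv_succ_apply_left]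
  simp [Fin.tail]
  rfl

section Naturality

variable {φ : OpenPartialHomeomorph F F} (hφ : ContDiffOn ℝ (⊤ : ℕ∞) φ φ.source)
  (hφ' : ContDiffOn ℝ (⊤ : ℕ∞) φ.symm φ.target)

include hφ hφ'

theorem fderiv_comp_fderiv_symm {q : F} (hq : q ∈ φ.target) :
    fderiv ℝ φ (φ.symm q) ∘L fderiv ℝ φ.symm q = ContinuousLinearMap.id ℝ F := by
  have h₁ := (φ.open_source.contDiffAt_of_contDiffOn hφ (φ.map_target hq)).differentiableAt
    (by simp)
  have h₂ := (φ.open_target.contDiffAt_of_contDiffOn hφ' hq).differentiableAt (by simp)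
  rw [← fderiv_comp q h₁ h₂, ← fderiv_id (𝕜 := ℝ) (x := q)]
  refine Filter.EventuallyEq.fderiv_eq ?_
  filter_upwards [φ.open_target.mem_nhds hq] with p hp
  exact φ.right_inv hp

theorem fderiv_symm_comp_fderiv {q : F} (hq : q ∈ φ.source) :
    fderiv ℝ φ.symm (φ q) ∘L fderiv ℝ φ q = ContinuousLinearMap.id ℝ F := by
  have h := fderiv_comp_fderiv_symm (φ := φ.symm) hφ' (by simpa using hφ) (q := q)
    (by simpa using hq)
  simpa using h

/-- Identifies the `inverse` in `pushforwardConnection` as a genuine inverse, so that its default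
value plays no role on the target. -/
theorem inverse_fderiv {q : F} (hq : q ∈ φ.target) :
    (fderiv ℝ φ (φ.symm q)).inverse = fderiv ℝ φ.symm q := by
  refine ContinuousLinearMap.inverse_eq (fderiv_comp_fderiv_symm hφ hφ' hq) ?_
  have := fderiv_symm_comp_fderiv hφ hφ' (φ.map_target hq)
  rwa [φ.right_inv hq] at this

/-- Christoffel symbols of the pushforward connection. -/
theorem fderiv_symm_pushforwardConnection_const {q : F} (hq : q ∈ φ.target) (w w' : F) :
    fderiv ℝ φ.symm q (pushforwardConnection φ (fun _ => w) (fun _ => w') q)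
      = fderiv ℝ (fderiv ℝ φ.symm) q w w' := by
  have hs := φ.map_target hq
  have hφq := φ.open_source.contDiffAt_of_contDiffOn hφ hs
  have hψq := φ.open_target.contDiffAt_of_contDiffOn hφ' hq
  have h₁ : HasFDerivAt (fun p => fderiv ℝ φ (φ.symm p))
      (fderiv ℝ (fderiv ℝ φ) (φ.symm q) ∘L fderiv ℝ φ.symm q) q :=
    hφq.differentiableAt_fderiv_top.hasFDerivAt.comp q
      (hψq.differentiableAt (by simp)).hasFDerivAt
  have h₂ := h₁.clm_apply (hψq.differentiableAt_fderiv_top.hasFDerivAt.clm_apply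
    (hasFDerivAt_const w' q))
  -- The function is constantly `w'` on the target. Comparing its zero derivative with the product
  -- rule expresses the second derivative of the inverse through that of `φ`.
  have h₃ : HasFDerivAt (fun p => fderiv ℝ φ (φ.symm p) (fderiv ℝ φ.symm p w'))
      (0 : F →L[ℝ] F) q := by
    refine (hasFDerivAt_const w' q).congr_of_eventuallyEq ?_
    filter_upwards [φ.open_target.mem_nhds hq] with p hp
    exact congrArg (fun L => L w') (fderiv_comp_fderiv_symm hφ hφ' hp)
  have h₄ := congrArg (fun L => L w) (h₂.unique h₃)
  simp at h₄
  have h₅ := congrArg (fderiv ℝ φ.symm q) h₄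
  have hid : ∀ x, fderiv ℝ φ.symm q (fderiv ℝ φ (φ.symm q) x) = x := fun x => by
    have := fderiv_symm_comp_fderiv hφ hφ' hs
    rw [φ.right_inv hq] at this
    exact congrArg (fun L => L x) this
  rw [map_add, hid, map_zero] at h₅
  rw [eq_neg_of_add_eq_zero_left h₅, pushforwardConnection, inverse_fderiv hφ hφ' hq,
    (hφq.isSymmSndFDerivAt (by simp; exact WithTop.coe_le_coe.2 le_top)).eq]
  simp

/-- Induction on `k`: the product rule yields the next derivative of `φ` plus terms in which the
second derivative of the inverse chart hits one argument. By the Christoffel identity these are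
exactly the corrections that the covariant derivative subtracts. -/
theorem covDerivFun_pushforward_id (k : ℕ) : ∀ q ∈ φ.target, ∀ w : Fin k → F,
    covDerivFun (pushforwardConnection φ) id k q w
      = iteratedFDeriv ℝ k φ (φ.symm q) fun i => fderiv ℝ φ.symm q (w i) := by
  induction k with
  | zero =>
    intro q hq w
    simp [covDerivFun, φ.right_inv hq]
  | succ k ih =>
    intro q hq w
    rw [covDerivFun, Filter.EventuallyEq.fderiv_eq (f :=
        fun q' => iteratedFDeriv ℝ k φ (φ.symm q') fun i => fderiv ℝ φ.symm q' (Fin.tail w i)),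
      (fderiv_iteratedFDeriv_comp_apply
        (φ.open_source.contDiffAt_of_contDiffOn hφ (φ.map_target hq))
        (φ.open_target.contDiffAt_of_contDiffOn hφ' hq) w).2, add_sub_assoc, sub_eq_zero.2,
      add_zero]
    · refine Finset.sum_congr rfl fun i _ => ?_
      rw [ih q hq, ← fderiv_symm_pushforwardConnection_const hφ hφ' hq]
      congr 1
      funext j
      by_cases hj : j = i
      · subst hj; simp
      · simp [Function.update_of_ne hj]
    · filter_upwards [φ.open_target.mem_nhds hq] with p hp
      exact ih p hp _

/-- As for functions, with one more cancellation: the derivative of the outer factor `fderiv ℝ φ` is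
removed by the Christoffel term of the connection acting on the field itself, by symmetry of the
second derivative of `φ`. -/
theorem covDerivField_pushforward {X : F → F} (hX : ContDiff ℝ (⊤ : ℕ∞) X) (k : ℕ) :
    ∀ q ∈ φ.target, ∀ w : Fin k → F,
    covDerivField (pushforwardConnection φ) (pushforwardField φ X) k q w
      = fderiv ℝ φ (φ.symm q)
          (iteratedFDeriv ℝ k X (φ.symm q) fun i => fderiv ℝ φ.symm q (w i)) := by
  induction k with
  | zero =>
    intro q hq w
    simp [covDerivField, pushforwardField]
  | succ k ih =>
    intro q hq w
    have hs := φ.map_target hq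
    have hφq := φ.open_source.contDiffAt_of_contDiffOn hφ hs
    have hψq := φ.open_target.contDiffAt_of_contDiffOn hφ' hq
    obtain ⟨hd, hd'⟩ := fderiv_iteratedFDeriv_comp_apply (f := X) hX.contDiffAt hψq w
    have h₁ : HasFDerivAt (fun p => fderiv ℝ φ (φ.symm p))
        (fderiv ℝ (fderiv ℝ φ) (φ.symm q) ∘L fderiv ℝ φ.symm q) q :=
      hφq.differentiableAt_fderiv_top.hasFDerivAt.comp q
        (hψq.differentiableAt (by simp)).hasFDerivAt
    have hid : ∀ x, fderiv ℝ φ.symm q (fderiv ℝ φ (φ.symm q) x) = x := fun x => by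
      have := fderiv_symm_comp_fderiv hφ hφ' hs
      rw [φ.right_inv hq] at this
      exact congrArg (fun L => L x) this
    rw [covDerivField, pushforwardConnection, Filter.EventuallyEq.fderiv_eq (f :=
        fun q' => fderiv ℝ φ (φ.symm q') (iteratedFDeriv ℝ k X (φ.symm q')
          fun i => fderiv ℝ φ.symm q' (Fin.tail w i))),
      (h₁.clm_apply hd.hasFDerivAt).fderiv]
    · simp only [add_apply, ContinuousLinearMap.comp_apply,
        ContinuousLinearMap.flip_apply]
      rw [hd', map_add, map_sum, ih q hq, inverse_fderiv hφ hφ' hq, hid,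
        (hφq.isSymmSndFDerivAt (by simp; exact WithTop.coe_le_coe.2 le_top)).eq
          (fderiv ℝ φ.symm q (w 0)), add_sub_cancel_right, add_sub_assoc, sub_eq_zero.2, add_zero]
      refine Finset.sum_congr rfl fun i _ => ?_
      rw [ih q hq, ← fderiv_symm_pushforwardConnection_const hφ hφ' hq]
      congr 2
      funext j
      by_cases hj : j = i
      · subst hj; simp
      · simp [Function.update_of_ne hj]
    · filter_upwards [φ.open_target.mem_nhds hq] with p hp
      exact ih p hp _

/-! ### Pushforward of elementary differentials -/

namespace RTree

variable {V : E → F → F} (hV : ∀ e, ContDiff ℝ (⊤ : ℕ∞) (V e)) {n : ℕ} {τ : RTree (Fin n)}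

include hV

omit [NormedAddCommGroup E] [NormedSpace ℝ E] in
-- Induction from the leaves: the derivative of `φ` carried by each child is cancelled by the
-- derivative of the inverse chart in the slot it is inserted into.
theorem vertexVal_pushforward {q : F} (hq : q ∈ φ.source) (e : Fin n → E) (v : Fin n) :
    τ.vertexVal (pushforwardConnection φ) (fun e => pushforwardField φ (V e)) (φ q) e v
      = fderiv ℝ φ q (τ.canonVal V q e v) := by
  refine τ.wellFounded_gt.induction (C := fun v =>
    τ.vertexVal (pushforwardConnection φ) (fun e => pushforwardField φ (V e)) (φ q) e v
      = fderiv ℝ φ q (τ.canonVal V q e v)) v ?_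
  intro v ih
  rw [vertexVal, covDerivField_pushforward hφ hφ' (hV _) _ _ (φ.map_source hq), φ.left_inv hq,
    canonVal_eq_orderEmb hV]
  congr 2
  funext j
  rw [ih _ (mem_children.1 ((τ.children v).orderEmbOfFin_mem rfl j)).1]
  exact congrArg (fun L : F →L[ℝ] F => L _) (fderiv_symm_comp_fderiv hφ hφ' hq)

omit [NormedAddCommGroup E] [NormedSpace ℝ E] in
/-- Naturality of elementary differentials. -/
theorem treeVal_pushforward {q : F} (hq : q ∈ φ.source) (e : Fin n → E) :
    τ.treeVal (pushforwardConnection φ) (fun e => pushforwardField φ (V e)) id (φ q) e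
      = τ.forestVal V q (iteratedFDeriv ℝ τ.roots.card φ q) e := by
  rw [treeVal, covDerivFun_pushforward_id hφ hφ' _ _ (φ.map_source hq), φ.left_inv hq, forestVal,
    dif_pos rfl]
  congr 1
  funext j
  rw [vertexVal_pushforward hφ hφ' hV hq]
  exact congrArg (fun L : F →L[ℝ] F => L _) (fderiv_symm_comp_fderiv hφ hφ' hq)

end RTree

end Naturality

omit [NormedAddCommGroup E] [NormedSpace ℝ E] in
theorem RTree.treeVal_canonical_id {V : E → F → F} {n : ℕ} {τ : RTree (Fin n)} {q : F}
    (e : Fin n → E) : τ.treeVal canonicalConnection V id q e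
      = τ.forestVal V q (iteratedFDeriv ℝ τ.roots.card id q) e := by
  rw [treeVal, covDerivFun_canonical contDiff_id, forestVal, dif_pos rfl]

/-! ### Uniform bounds on derivatives of a linear family of vector fields -/

section LinearFamily

variable {V : E → F → F} (hVlin : ∀ q, IsLinearMap ℝ fun e => V e q)
  (hV : ∀ e, ContDiff ℝ (⊤ : ℕ∞) (V e))

include hVlin hV

theorem isLinearMap_iteratedFDeriv (q : F) (k : ℕ) (w : Fin k → F) :
    IsLinearMap ℝ fun e => iteratedFDeriv ℝ k (V e) q w := by
  have h : ∀ e, ContDiffAt ℝ k (V e) q := fun e =>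
    ((hV e).of_le (by exact_mod_cast le_top)).contDiffAt
  refine ⟨fun a b => ?_, fun c a => ?_⟩
  · rw [show V (a + b) = V a + V b from funext fun q => (hVlin q).map_add a b,
      iteratedFDeriv_add_apply (h a) (h b)]
    rfl
  · rw [show V (c • a) = c • V a from funext fun q => (hVlin q).map_smul c a,
      iteratedFDeriv_const_smul_apply (h a)]
    rfl

/-- Continuity in `e` is assumed only for the fields, not for their derivatives. A derivative is a
pointwise limit of difference quotients, which are continuous and linear in `e`, and on a Banach
space such a limit is again continuous. -/
theorem exists_continuousLinearMap_iteratedFDeriv [CompleteSpace E]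
    (hVcont : ∀ q, Continuous fun e => V e q) (k : ℕ) :
    ∀ (q : F) (w : Fin k → F), ∃ L : E →L[ℝ] F, ∀ e, L e = iteratedFDeriv ℝ k (V e) q w := by
  induction k with
  | zero => exact fun q w => ⟨⟨(hVlin q).mk' _, hVcont q⟩, fun e => by simp; rfl⟩
  | succ k ih =>
    intro q w
    choose L hL using ih
    let g : ℝ → E →L[ℝ] F := fun t =>
      t⁻¹ • (L (q + t • w 0) (Fin.tail w) - L q (Fin.tail w))
    have h : Filter.Tendsto (fun t e => g t e) (𝓝[≠] 0)
        (𝓝 fun e => iteratedFDeriv ℝ (k + 1) (V e) q w) := by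
      rw [tendsto_pi_nhds]
      intro e
      have hd := (((hV e).contDiffAt (x := q)).differentiableAt_iteratedFDeriv_top
        k).hasFDerivAt.continuousMultilinear_apply_const (Fin.tail w)
      have hd' := (hd.hasLineDerivAt (w 0)).tendsto_slope_zero
      rw [iteratedFDeriv_succ_apply_left]
      simpa [g, hL] using hd'
    exact ⟨continuousLinearMapOfTendsto g h, fun e => rfl⟩

/-- Banach–Steinhaus for the family indexed by base points in `K` and vectors of norm at most 1: for
fixed `e` the family is bounded since `K` is compact and the derivative of `V e` is continuous. -/
theorem exists_bound_iteratedFDeriv_of_isCompact [CompleteSpace E]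
    (hVcont : ∀ q, Continuous fun e => V e q) {K : Set F} (hK : IsCompact K) (k : ℕ) :
    ∃ C, 0 ≤ C ∧ ∀ q ∈ K, ∀ e, ‖iteratedFDeriv ℝ k (V e) q‖ ≤ C * ‖e‖ := by
  choose L hL using exists_continuousLinearMap_iteratedFDeriv hVlin hV hVcont k
  obtain ⟨C, hC⟩ := banach_steinhaus
    (g := fun i : {i : F × (Fin k → F) // i.1 ∈ K ∧ ∀ j, ‖i.2 j‖ ≤ 1} => L i.1.1 i.1.2)
    fun e => by
      have hcont : Continuous (iteratedFDeriv ℝ k (V e)) :=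
        (hV e).continuous_iteratedFDeriv (by exact_mod_cast le_top)
      obtain ⟨B, hB⟩ := hK.exists_bound_of_continuousOn hcont.continuousOn
      refine ⟨B, fun i => ?_⟩
      rw [hL]
      refine (ContinuousMultilinearMap.le_opNorm _ _).trans
        ((mul_le_of_le_one_right (norm_nonneg _) ?_).trans (hB _ i.2.1))
      exact Finset.prod_le_one (fun _ _ => norm_nonneg _) fun j _ => i.2.2 j
  refine ⟨max C 0, le_max_right _ _, fun q hq e => ?_⟩
  refine ContinuousMultilinearMap.opNorm_le_bound (by positivity) fun w => ?_
  -- Normalises all arguments at once; a zero argument stays zero under the convention `0⁻¹ = 0`.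
  have hw : w = fun i => ‖w i‖ • (‖w i‖⁻¹ • w i) := by
    funext i
    by_cases h : w i = 0
    · simp [h]
    · rw [smul_smul, mul_inv_cancel₀ (norm_ne_zero_iff.2 h), one_smul]
  conv_lhs => rw [hw]
  rw [ContinuousMultilinearMap.map_smul_univ, norm_smul, mul_comm, ← hL]
  refine mul_le_mul ?_ ?_ (norm_nonneg _) (by positivity)
  · refine ((L _ _).le_opNorm e).trans (mul_le_mul_of_nonneg_right
      ((hC ⟨(q, _), hq, fun j => ?_⟩).trans (le_max_left _ _)) (norm_nonneg _))
    rw [norm_smul, norm_inv, norm_norm]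
    exact inv_mul_le_one_of_le₀ le_rfl (norm_nonneg _)
  · rw [norm_prod]
    simp

theorem exists_bound_iteratedFDeriv_le [CompleteSpace E]
    (hVcont : ∀ q, Continuous fun e => V e q) {K : Set F} (hK : IsCompact K) (N : ℕ) :
    ∃ C, 0 ≤ C ∧ ∀ q ∈ K, ∀ k ≤ N, ∀ e, ‖iteratedFDeriv ℝ k (V e) q‖ ≤ C * ‖e‖ := by
  choose C hC0 hC using exists_bound_iteratedFDeriv_of_isCompact hVlin hV hVcont hK
  refine ⟨∑ k ∈ Finset.range (N + 1), C k, Finset.sum_nonneg fun k _ => hC0 k,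
    fun q hq k hk e => (hC k q hq e).trans ?_⟩
  exact mul_le_mul_of_nonneg_right (Finset.single_le_sum (f := C) (fun k _ => hC0 k)
    (Finset.mem_range.2 (by omega))) (norm_nonneg _)

end LinearFamily

/-! ### Extension of multilinear maps to completed tensor powers -/

theorem SymmCrossNorm.DominatesProjective.exists_bound {ν : SymmCrossNorm E} {N : ℕ}
    (hν : ν.DominatesProjective N) : ∃ D, 0 ≤ D ∧ ∀ n ≤ N, ∀ a : ⨂[ℝ]^n E,
      PiTensorProduct.projectiveSeminorm a ≤ D * ν.nrm n a := by
  have h : ∀ n : ℕ, ∃ C : ℝ, n ≤ N → ∀ a : ⨂[ℝ]^n E,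
      PiTensorProduct.projectiveSeminorm a ≤ C * ν.nrm n a := fun n => by
    by_cases hn : n ≤ N
    · exact (hν n hn).imp fun C hC _ => hC
    · exact ⟨0, fun h => (hn h).elim⟩
  choose C hC using h
  refine ⟨∑ n ∈ Finset.range (N + 1), |C n|, Finset.sum_nonneg fun _ _ => abs_nonneg _,
    fun n hn a => (hC n hn a).trans (mul_le_mul_of_nonneg_right ?_ (apply_nonneg _ _))⟩
  exact (le_abs_self _).trans (Finset.single_le_sum (f := fun n => |C n|)
    (fun _ _ => abs_nonneg _) (Finset.mem_range.2 (by omega)))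

/-- A bounded multilinear map lifts to a functional that is bounded for the projective seminorm,
hence by `hD` for the chosen one, and then extends from the dense algebraic tensors to the
completion. -/
theorem exists_extension_of_bound [CompleteSpace G] {n : ℕ} {D c : ℝ} (hD0 : 0 ≤ D) (hc : 0 ≤ c)
    (hD : ∀ a : ⨂[ℝ]^n E, PiTensorProduct.projectiveSeminorm a ≤ D * ν.nrm n a)
    {B : (Fin n → E) → G} (hB : ∀ e i, IsLinearMap ℝ fun c => B (Function.update e i c))
    (hBc : ∀ e, ‖B e‖ ≤ c * ∏ i, ‖e i‖) :
    ∃ L : CPow ν n →L[ℝ] G, (∀ e, L (pureC ν e) = B e) ∧ ‖L‖ ≤ c * D := by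
  let M : MultilinearMap ℝ (fun _ : Fin n => E) G :=
    MultilinearMap.mk' B (fun e i x y => (hB e i).map_add x y)
      (fun e i r x => (hB e i).map_smul r x)
  let A : ContinuousMultilinearMap ℝ (fun _ : Fin n => E) G := M.mkContinuous c hBc
  have hA : ‖A‖ ≤ c := MultilinearMap.mkContinuous_norm_le _ hc _
  let L₀ : TPow ν n →L[ℝ] G := LinearMap.mkContinuous
    (PiTensorProduct.lift A.toMultilinearMap ∘ₗ (TPow.equiv ν n).toLinearMap) (c * D) fun a => by
      refine (PiTensorProduct.norm_eval_le_projectiveSeminorm A (TPow.equiv ν n a)).trans ?_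
      rw [mul_assoc]
      exact mul_le_mul hA (hD _) (norm_nonneg _) hc
  have hext : ∀ a, L₀.extend (toCPow ν n) (toCPow ν n a) = L₀ a := fun a =>
    ContinuousLinearMap.extend_eq _ (denseRange_toCPow ν n) (isUniformInducing_toCPow ν n) a
  refine ⟨L₀.extend (toCPow ν n), fun e => ?_, ?_⟩
  · rw [pureC, hext]
    exact PiTensorProduct.lift.tprod e
  · refine ContinuousLinearMap.opNorm_le_bound _ (by positivity) fun x => ?_
    refine (denseRange_toCPow ν n).induction_on x
      (isClosed_le (by fun_prop) (by fun_prop)) fun a => ?_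
    rw [hext, norm_toCPow]
    exact LinearMap.mkContinuous_norm_le _ (by positivity) _ |> L₀.le_of_opNorm_le <| a

/-! ### Decomposition of trees along the children of the root -/

namespace RTree

/-- The tree obtained by identifying the roots of two trees. -/
def join {m l : ℕ} (α : RTree (Fin m)) (β : RTree (Fin l)) : RTree (Fin (m + l)) :=
  (α.graft β fun _ => none).comap finSumFinEquiv.symm.toEmbedding

theorem comap_inl_join {m l : ℕ} (α : RTree (Fin m)) (β : RTree (Fin l)) :
    (α.join β).comap (Function.Embedding.inl.trans finSumFinEquiv.toEmbedding) = α := by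
  ext a b
  simp [join, comap, graft]

theorem comap_inr_join {m l : ℕ} (α : RTree (Fin m)) (β : RTree (Fin l)) :
    (α.join β).comap (Function.Embedding.inr.trans finSumFinEquiv.toEmbedding) = β := by
  ext a b
  simp [join, comap, graft]

theorem upClosed_inl_join {m l : ℕ} (α : RTree (Fin m)) (β : RTree (Fin l)) :
    (α.join β).UpClosed (Function.Embedding.inl.trans finSumFinEquiv.toEmbedding) := by
  intro a w
  obtain ⟨w, rfl⟩ := finSumFinEquiv.surjective w
  rcases w with w | w
  · exact fun _ => ⟨w, rfl⟩
  · simp [join, comap, graft]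

theorem upClosed_inr_join {m l : ℕ} (α : RTree (Fin m)) (β : RTree (Fin l)) :
    (α.join β).UpClosed (Function.Embedding.inr.trans finSumFinEquiv.toEmbedding) := by
  intro a w
  obtain ⟨w, rfl⟩ := finSumFinEquiv.surjective w
  rcases w with w | w
  · simp [join, comap, graft]
  · exact fun _ => ⟨w, rfl⟩

omit [NormedAddCommGroup E] [NormedSpace ℝ E] in
theorem forestVal_split_equiv {V : E → F → F} (hV : ∀ e, ContDiff ℝ (⊤ : ℕ∞) (V e)) {q : F}
    {n m l k : ℕ} {τ : RTree (Fin n)} (s : Fin m ⊕ Fin l ≃ Fin n)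
    (hf : τ.UpClosed (Function.Embedding.inl.trans s.toEmbedding))
    (hg : τ.UpClosed (Function.Embedding.inr.trans s.toEmbedding))
    (hone : (τ.comap (Function.Embedding.inl.trans s.toEmbedding)).roots.card = 1)
    {A : F [×(k + 1)]→L[ℝ] G} (hA : A.IsSymm) (e : Fin n → E) :
    τ.forestVal V q A e
      = (τ.comap (Function.Embedding.inr.trans s.toEmbedding)).forestVal V q
        (A.curryLeft ((τ.comap (Function.Embedding.inl.trans s.toEmbedding)).forestVal V q idOne
          fun i => e (s (Sum.inl i)))) fun i => e (s (Sum.inr i)) := by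
  refine forestVal_split hV hf hg (fun w => ?_) (fun a b => ?_) hone hA e
  · obtain ⟨w, rfl⟩ := s.surjective w
    rcases w with w | w
    exacts [Or.inl ⟨w, rfl⟩, Or.inr ⟨w, rfl⟩]
  · simp

/-! ### Enumerations of a set of branches and of its complement -/

section Branches

variable {n m l : ℕ} {τ : RTree (Fin n)} {I : Finset (Fin n)}
  (h : (τ.branches I).card = m ∧ (τ.branches I)ᶜ.card = l)

/-- Enumeration of the branches in `I` by the left summand and of the other vertices by the right
summand. -/
abbrev branchEquiv : Fin m ⊕ Fin l ≃ Fin n := finSumEquivOfFinset h.1 h.2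

theorem range_branchEquiv_inl :
    Set.range (Function.Embedding.inl.trans (branchEquiv h).toEmbedding) = τ.branches I := by
  rw [← Finset.range_orderEmbOfFin _ h.1]
  congr 1

theorem range_branchEquiv_inr :
    Set.range (Function.Embedding.inr.trans (branchEquiv h).toEmbedding)
      = ((τ.branches I)ᶜ : Finset (Fin n)) := by
  rw [← Finset.range_orderEmbOfFin _ h.2]
  congr 1

theorem upClosed_branchEquiv_inl :
    τ.UpClosed (Function.Embedding.inl.trans (branchEquiv h).toEmbedding) := by
  intro a w hw
  have ha : (Function.Embedding.inl.trans (branchEquiv h).toEmbedding) a ∈ τ.branches I := by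
    rw [← Finset.mem_coe, ← range_branchEquiv_inl h]; exact ⟨a, rfl⟩
  rw [range_branchEquiv_inl, Finset.mem_coe]
  exact upClosed_of_mem_branches ha hw

/-- Since `I` consists of children of the root, its branches are also closed downwards among the
non-root vertices. -/
theorem upClosed_branchEquiv_inr (hI : I ⊆ τ.roots) :
    τ.UpClosed (Function.Embedding.inr.trans (branchEquiv h).toEmbedding) := by
  intro a w hw
  have ha : (Function.Embedding.inr.trans (branchEquiv h).toEmbedding) a
      ∈ (τ.branches I)ᶜ := by
    rw [← Finset.mem_coe, ← range_branchEquiv_inr h]; exact ⟨a, rfl⟩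
  rw [range_branchEquiv_inr, Finset.mem_coe, Finset.mem_compl]
  exact fun hb => Finset.mem_compl.1 ha (mem_branches_of_le hI hb hw)

theorem card_roots_branchEquiv (hI : I ⊆ τ.roots) :
    (τ.comap (Function.Embedding.inl.trans (branchEquiv h).toEmbedding)).roots.card
      = I.card := by
  classical
  set f := Function.Embedding.inl.trans (branchEquiv h).toEmbedding
  rw [← Finset.card_map f]
  congr 1
  have hroots : ∀ a, f a ∈ τ.roots ↔ a ∈ (τ.comap f).roots :=
    mem_roots_iff_of_upClosed (upClosed_branchEquiv_inr h hI)
      (fun w => by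
        obtain ⟨w, rfl⟩ := (branchEquiv h).surjective w
        rcases w with w | w
        exacts [Or.inl ⟨w, rfl⟩, Or.inr ⟨w, rfl⟩])
      (fun a b hab => by
        have := (branchEquiv h).injective (a₁ := .inl a) (a₂ := .inr b) hab
        cases this)
  ext v
  simp only [Finset.mem_map]
  constructor
  · rintro ⟨a, ha, rfl⟩
    have hb : f a ∈ τ.branches I := by
      rw [← Finset.mem_coe, ← range_branchEquiv_inl h]; exact ⟨a, rfl⟩
    simp only [branches, Finset.mem_filter, Finset.mem_univ, true_and] at hb
    obtain ⟨r, hr, hle⟩ := hb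
    rwa [← eq_of_mem_roots ((hroots a).2 ha) hle]
  · intro hv
    have hb : v ∈ Set.range f := by
      rw [range_branchEquiv_inl, Finset.mem_coe]
      simp only [branches, Finset.mem_filter, Finset.mem_univ, true_and]
      exact ⟨v, hv, τ.le_refl v⟩
    obtain ⟨a, rfl⟩ := hb
    exact ⟨a, (hroots a).1 (hI hv), rfl⟩

end Branches

end RTree

/-! ### Elementary differentials of group-like elements -/

section GroupLike

open RTree

variable (V : E → F → F) (q : F)

/-- The part of the elementary differential that belongs to trees of degree `n` whose root has `k`
children. -/
def forestSum {k : ℕ} (A : F [×k]→L[ℝ] G) {n : ℕ} (x : RawTree ν n) : G :=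
  ∑ τ, extendMultilinear ν (τ.forestVal V q A) (x τ)

/-- The sum over all trees of degree `n` whose root has one child. -/
def primitivePart {n : ℕ} (x : RawTree ν n) : F := forestSum ν V q idOne x

/-- The elementary differentials up to degree `N` extend to the completed tensor powers. -/
def ForestExtends (G : Type*) [NormedAddCommGroup G] [NormedSpace ℝ G] (N : ℕ) : Prop :=
  ∀ n ≤ N, ∀ (τ : RTree (Fin n)) (k : ℕ) (A : F [×k]→L[ℝ] G) (e : Fin n → E),
    extendMultilinear ν (τ.forestVal V q A) (pureC ν e) = τ.forestVal V q A e

variable {ν V q} {N : ℕ} (hG : ForestExtends ν V q G N) (hF : ForestExtends ν V q F N)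

omit [NormedAddCommGroup E] [NormedSpace ℝ E] in
theorem forestVal_sum {ι : Type*} (s : Finset ι) {n k : ℕ} {τ : RTree (Fin n)}
    (A : ι → F [×k]→L[ℝ] G) (e : Fin n → E) :
    τ.forestVal V q (∑ i ∈ s, A i) e = ∑ i ∈ s, τ.forestVal V q (A i) e := by
  unfold forestVal
  split_ifs
  · exact sum_apply s A _
  · simp

include hG in
-- `extendMultilinear` is zero when no extension exists, so additivity in `A` relies on the summands
-- really extending.
theorem forestSum_sum {ι : Type*} (s : Finset ι) {n k : ℕ} (hn : n ≤ N)
    (A : ι → F [×k]→L[ℝ] G) (x : RawTree ν n) :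
    forestSum ν V q (∑ i ∈ s, A i) x = ∑ i ∈ s, forestSum ν V q (A i) x := by
  unfold forestSum
  rw [Finset.sum_comm]
  refine Finset.sum_congr rfl fun τ _ => ?_
  rw [extendMultilinear_eq ν (L := ∑ i ∈ s, extendMultilinear ν (τ.forestVal V q (A i)))]
  · exact sum_apply _ _ _
  · intro e
    rw [sum_apply, forestVal_sum]
    exact Finset.sum_congr rfl fun i _ => hG n hn τ k (A i) e

theorem extendMultilinear_forestVal_of_card_ne {n k : ℕ} {τ : RTree (Fin n)}
    (h : τ.roots.card ≠ k) (A : F [×k]→L[ℝ] G) :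
    extendMultilinear ν (τ.forestVal V q A) = 0 :=
  extendMultilinear_eq ν fun e => by simp [forestVal, h]

theorem extendMultilinear_forestVal_zero {n k : ℕ} {τ : RTree (Fin n)} :
    extendMultilinear ν (τ.forestVal V q (0 : F [×k]→L[ℝ] G)) = 0 :=
  extendMultilinear_eq ν fun e => by simp [forestVal]

variable (hV : ∀ e, ContDiff ℝ (⊤ : ℕ∞) (V e))

include hG hV in
-- Up to relabelling, `τ` is the join of its branch above `I` with the rest, and `permC` moves the
-- labels accordingly. On elementary tensors both sides split in the same way.
theorem extendMultilinear_forestVal_perm {m l k : ℕ} (hn : m + l ≤ N) {τ : RTree (Fin (m + l))}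
    {I : Finset (Fin (m + l))} (hI : I ⊆ τ.roots) (hone : I.card = 1)
    (h : (τ.branches I).card = m ∧ (τ.branches I)ᶜ.card = l)
    {A : F [×(k + 1)]→L[ℝ] G} (hA : A.IsSymm) (x : CPow ν (m + l)) :
    extendMultilinear ν ((RTree.join
        (τ.comap (Function.Embedding.inl.trans (branchEquiv h).toEmbedding))
        (τ.comap (Function.Embedding.inr.trans (branchEquiv h).toEmbedding))).forestVal V q A)
        (permC ν ((branchEquiv h).symm.trans finSumFinEquiv) x)
      = extendMultilinear ν (τ.forestVal V q A) x := by
  set α := τ.comap (Function.Embedding.inl.trans (branchEquiv h).toEmbedding) with hα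
  set β := τ.comap (Function.Embedding.inr.trans (branchEquiv h).toEmbedding) with hβ
  have hα1 : α.roots.card = 1 := (card_roots_branchEquiv h hI).trans hone
  suffices H : extendMultilinear ν ((RTree.join α β).forestVal V q A) ∘L
      permC ν ((branchEquiv h).symm.trans finSumFinEquiv)
      = extendMultilinear ν (τ.forestVal V q A) from congrArg (fun L => L x) H
  refine CPow.ext_pureC ν fun e => ?_
  rw [ContinuousLinearMap.comp_apply, permC_pureC, hG _ hn, hG _ hn,
    forestVal_split_equiv hV (branchEquiv h) (upClosed_branchEquiv_inl h)
      (upClosed_branchEquiv_inr h hI) hα1 hA,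
    forestVal_split_equiv hV finSumFinEquiv (upClosed_inl_join α β) (upClosed_inr_join α β)
      (by rw [comap_inl_join]; exact hα1) hA, comap_inl_join, comap_inr_join, ← hα, ← hβ]
  simp

include hG hF hV in
-- The value of a join is the value of `β` with the vector of the single branch `α` in the first
-- slot. Both sides are continuous and linear in `b`, and then in `a`, so elementary tensors
-- suffice.
theorem extendMultilinear_forestVal_mulC {m l k : ℕ} (hn : m + l ≤ N) {α : RTree (Fin m)}
    {β : RTree (Fin l)} (hα : α.roots.card = 1) {A : F [×(k + 1)]→L[ℝ] G} (hA : A.IsSymm)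
    (a : CPow ν m) (b : CPow ν l) :
    extendMultilinear ν ((α.join β).forestVal V q A) (mulC ν rfl a b)
      = extendMultilinear ν (β.forestVal V q
          (A.curryLeft (extendMultilinear ν (α.forestVal V q idOne) a))) b := by
  suffices H : ∀ (a : CPow ν m), extendMultilinear ν ((α.join β).forestVal V q A) ∘L mulC ν rfl a
      = extendMultilinear ν (β.forestVal V q
          (A.curryLeft (extendMultilinear ν (α.forestVal V q idOne) a))) from
    congrArg (fun L => L b) (H a)
  intro a
  refine CPow.ext_pureC ν fun eb => ?_
  rw [hG l (by omega)]
  by_cases hk : β.roots.card = k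
  · let Lb : F →L[ℝ] G :=
      ContinuousMultilinearMap.apply ℝ (fun _ : Fin k => F) G
        (fun j => β.canonVal V q eb (β.roots.orderEmbOfFin hk j)) ∘L A.curryLeft
    have hLb : ∀ u, β.forestVal V q (A.curryLeft u) eb = Lb u := fun u => by
      rw [forestVal, dif_pos hk]; rfl
    rw [hLb]
    suffices H : (extendMultilinear ν ((α.join β).forestVal V q A)) ∘L
        (mulC ν rfl).flip (pureC ν eb)
        = Lb ∘L extendMultilinear ν (α.forestVal V q idOne) from congrArg (fun L => L a) H
    refine CPow.ext_pureC ν fun ea => ?_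
    rw [ContinuousLinearMap.comp_apply, ContinuousLinearMap.flip_apply, mulC_pureC, hG _ hn,
      forestVal_split_equiv hV finSumFinEquiv (upClosed_inl_join α β) (upClosed_inr_join α β)
      (by rw [comap_inl_join]; exact hα) hA, comap_inl_join, comap_inr_join,
      ContinuousLinearMap.comp_apply, hF m (by omega), ← hLb]
    simp
  · suffices H : (extendMultilinear ν ((α.join β).forestVal V q A)) ∘L
        (mulC ν rfl).flip (pureC ν eb) = 0 by
      rw [forestVal, dif_neg hk]
      exact congrArg (fun L => L a) H
    refine CPow.ext_pureC ν fun ea => ?_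
    rw [ContinuousLinearMap.comp_apply, ContinuousLinearMap.flip_apply, mulC_pureC, hG _ hn,
      forestVal_split_equiv hV finSumFinEquiv (upClosed_inl_join α β) (upClosed_inr_join α β)
      (by rw [comap_inl_join]; exact hα) hA, comap_inl_join, comap_inr_join,
      forestVal, dif_neg hk]
    rfl

open Classical in
include hG hV in
/-- Pairing the coproduct with elementary differentials. -/
theorem sum_extendMultilinear_coprod {m l k : ℕ} (hn : m + l ≤ N)
    {A : F [×(k + 1)]→L[ℝ] G} (hA : A.IsSymm) (x : RawTree ν (m + l)) :
    ∑ α : RTree (Fin m), ∑ β : RTree (Fin l), (if α.roots.card = 1 then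
        extendMultilinear ν ((α.join β).forestVal V q A) (coprod ν m l x α β) else 0)
      = ∑ τ, ∑ I ∈ τ.roots.powerset, if I.card = 1 ∧ (τ.branches I).card = m then
          extendMultilinear ν (τ.forestVal V q A) (x τ) else 0 := by
  have h₁ : ∀ (α : RTree (Fin m)) (β : RTree (Fin l)), (if α.roots.card = 1 then
      extendMultilinear ν ((α.join β).forestVal V q A) (coprod ν m l x α β) else 0)
      = ∑ τ, ∑ I ∈ τ.roots.powerset,
        if h : (τ.branches I).card = m ∧ (τ.branches I)ᶜ.card = l then
          if τ.comap (Function.Embedding.inl.trans (branchEquiv h).toEmbedding) = α ∧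
            τ.comap (Function.Embedding.inr.trans (branchEquiv h).toEmbedding) = β
          then if α.roots.card = 1 then extendMultilinear ν ((α.join β).forestVal V q A)
            (permC ν ((branchEquiv h).symm.trans finSumFinEquiv) (x τ)) else 0 else 0
        else 0 := by
    intro α β
    split_ifs with hα
    · unfold coprod
      simp only [map_sum]
      refine Finset.sum_congr rfl fun τ _ => Finset.sum_congr rfl fun I _ => ?_
      split_ifs <;> simp
    · symm
      refine Finset.sum_eq_zero fun τ _ => Finset.sum_eq_zero fun I _ => ?_
      split_ifs <;> rfl
  simp only [h₁]
  have h₂ : ∀ f : RTree (Fin m) → RTree (Fin l) → RTree (Fin (m + l)) →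
      Finset (Fin (m + l)) → G,
      ∑ α, ∑ β, ∑ τ, ∑ I ∈ τ.roots.powerset, f α β τ I
        = ∑ τ, ∑ I ∈ τ.roots.powerset, ∑ α, ∑ β, f α β τ I := by
    intro f
    simp only [← Fintype.sum_prod_type' (f := fun α β => ∑ τ, ∑ I ∈ τ.roots.powerset, f α β τ I),
      ← Fintype.sum_prod_type' (f := fun α β => f α β _ _)]
    rw [Finset.sum_comm]
    exact Finset.sum_congr rfl fun τ _ => Finset.sum_comm
  rw [h₂]
  refine Finset.sum_congr rfl fun τ _ => Finset.sum_congr rfl fun I hI => ?_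
  rw [Finset.mem_powerset] at hI
  by_cases hm : (τ.branches I).card = m
  · have h : (τ.branches I).card = m ∧ (τ.branches I)ᶜ.card = l := by
      refine ⟨hm, ?_⟩
      rw [Finset.card_compl, Fintype.card_fin]
      omega
    simp only [dif_pos h]
    -- A given pair `(τ, I)` contributes to exactly one pair `(α, β)`, namely its two restrictions.
    rw [Finset.sum_eq_single
        (τ.comap (Function.Embedding.inl.trans (branchEquiv h).toEmbedding)),
      Finset.sum_eq_single
        (τ.comap (Function.Embedding.inr.trans (branchEquiv h).toEmbedding)),
      if_pos ⟨rfl, rfl⟩, card_roots_branchEquiv h hI]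
    · by_cases hone : I.card = 1
      · rw [if_pos hone, if_pos ⟨hone, hm⟩]
        exact extendMultilinear_forestVal_perm hG hV hn hI hone h hA _
      · rw [if_neg hone, if_neg fun h => hone h.1]
    · exact fun β _ hβ => if_neg fun h => hβ h.2.symm
    · exact fun h => (h (Finset.mem_univ _)).elim
    · exact fun α _ hα => Finset.sum_eq_zero fun β _ => if_neg fun h => hα h.1.symm
    · exact fun h => (h (Finset.mem_univ _)).elim
  · rw [if_neg fun h => hm h.2]
    exact Finset.sum_eq_zero fun α _ => Finset.sum_eq_zero fun β _ => dif_neg fun h => hm h.1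

open Classical in
include hG hF hV in
-- Group-likeness enters here: the product of the components of `g` in degrees `m` and `l` is
-- replaced by a component of the coproduct, and the latter is regrouped by the original tree and
-- the branch cut from it.
theorem forestSum_curryLeft_primitivePart {g : TreeAlg ν} (hg : IsGroupLike ν g) {m l n k : ℕ}
    (hml : m + l = n) (hn : n ≤ N) {A : F [×(k + 1)]→L[ℝ] G} (hA : A.IsSymm) :
    forestSum ν V q (A.curryLeft (primitivePart ν V q (g m : RawTree ν m)))
        (g l : RawTree ν l)
      = ∑ τ, ∑ I ∈ τ.roots.powerset, if I.card = 1 ∧ (τ.branches I).card = m then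
          extendMultilinear ν (τ.forestVal V q A) ((g n : RawTree ν n) τ) else 0 := by
  subst hml
  rw [← sum_extendMultilinear_coprod hG hV hn hA, show primitivePart ν V q (g m : RawTree ν m)
      = ∑ α, extendMultilinear ν (α.forestVal V q idOne) ((g m : RawTree ν m) α) from rfl,
    map_sum, forestSum_sum hG _ (by omega)]
  refine Finset.sum_congr rfl fun α _ => ?_
  unfold forestSum
  refine Finset.sum_congr rfl fun β _ => ?_
  split_ifs with hα
  · rw [hg.2, extendMultilinear_forestVal_mulC hG hF hV hn hα hA]
  · rw [extendMultilinear_forestVal_of_card_ne hα, zero_apply,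
      map_zero, extendMultilinear_forestVal_zero, zero_apply]

include hG hF hV in
/-- The derivation property that characterises exponentials of primitive elements. -/
theorem sum_antidiagonal_forestSum {g : TreeAlg ν} (hg : IsGroupLike ν g) {n k : ℕ}
    (hn : n ≤ N) {A : F [×(k + 1)]→L[ℝ] G} (hA : A.IsSymm) :
    ∑ ml ∈ Finset.HasAntidiagonal.antidiagonal n, forestSum ν V q
        (A.curryLeft (primitivePart ν V q (g ml.1 : RawTree ν ml.1))) (g ml.2 : RawTree ν ml.2)
      = (k + 1 : ℝ) • forestSum ν V q A (g n : RawTree ν n) := by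
  classical
  rw [Finset.sum_congr rfl fun ml hml => forestSum_curryLeft_primitivePart hG hF hV hg
    (Finset.HasAntidiagonal.mem_antidiagonal.1 hml) hn hA, Finset.sum_comm, forestSum, Finset.smul_sum]
  refine Finset.sum_congr rfl fun τ _ => ?_
  set X := extendMultilinear ν (τ.forestVal V q A) ((g n : RawTree ν n) τ) with hX
  rw [Finset.sum_comm]
  -- The set `I` fixes the degree split. What is left counts the one-element sets of children of the
  -- root, of which there are `k + 1` whenever the tree contributes.
  have h₁ : ∀ I ∈ τ.roots.powerset, (∑ ml ∈ Finset.HasAntidiagonal.antidiagonal n,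
      if I.card = 1 ∧ (τ.branches I).card = ml.1 then X else 0) = if I.card = 1 then X else 0 := by
    intro I _
    have hc : (τ.branches I).card ≤ n := (Finset.card_le_univ _).trans (by simp)
    rw [Finset.sum_eq_single ((τ.branches I).card, n - (τ.branches I).card)]
    · simp
    · rintro ⟨m, l⟩ hml hne
      rw [Finset.HasAntidiagonal.mem_antidiagonal] at hml
      refine if_neg fun h => hne ?_
      ext
      · exact h.2.symm
      · simp only at hml h ⊢
        omega
    · intro h
      exact (h (Finset.HasAntidiagonal.mem_antidiagonal.2 (by simp only; omega))).elim
  rw [Finset.sum_congr rfl h₁, ← Finset.sum_filter, ← Finset.powersetCard_eq_filter,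
    Finset.sum_const, Finset.card_powersetCard, Nat.choose_one_right]
  by_cases hk : τ.roots.card = k + 1
  · rw [hk, ← Nat.cast_smul_eq_nsmul ℝ]
    push_cast
    rfl
  · rw [hX, extendMultilinear_forestVal_of_card_ne hk, zero_apply, smul_zero,
      smul_zero]

end GroupLike

/-! ### The exponential formula for group-like elements -/

section Counit

open RTree

variable {ν}

theorem permC_eq_self {n : ℕ} {σ : Equiv.Perm (Fin n)} (hσ : ∀ i, σ i = i) (x : CPow ν n) :
    permC ν σ x = x := by
  have hσ' : σ = Equiv.refl _ := Equiv.ext hσ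
  have : permC ν σ = ContinuousLinearMap.id ℝ _ := CPow.ext_pureC ν fun e => by
    rw [permC_pureC, hσ']
    rfl
  rw [this]
  rfl

instance : Subsingleton (RTree (Fin 0)) := ⟨fun α β => by ext a; exact a.elim0⟩

theorem RTree.branches_roots {n : ℕ} (τ : RTree (Fin n)) : τ.branches τ.roots = Finset.univ := by
  classical
  ext v
  simpa [branches] using τ.exists_root_le v

theorem RTree.eq_roots_of_branches_eq_univ {n : ℕ} {τ : RTree (Fin n)} {I : Finset (Fin n)}
    (hI : I ⊆ τ.roots) (h : τ.branches I = Finset.univ) : I = τ.roots := by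
  classical
  refine hI.antisymm fun v hv => ?_
  have hb : v ∈ τ.branches I := h ▸ Finset.mem_univ v
  simp only [branches, Finset.mem_filter, Finset.mem_univ, true_and] at hb
  obtain ⟨r, hr, hle⟩ := hb
  rwa [← eq_of_mem_roots hv hle]

/-- The enumeration is increasing, and the only strictly increasing self-map of `Fin n` is the
identity. -/
theorem RTree.branchEquiv_inl_of_univ {n : ℕ} {τ : RTree (Fin n)} {I : Finset (Fin n)}
    (h : (τ.branches I).card = n ∧ (τ.branches I)ᶜ.card = 0) (a : Fin n) :
    branchEquiv h (Sum.inl a) = a := by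
  have hm : StrictMono fun a => branchEquiv h (Sum.inl a) := by
    intro a b hab
    simpa using hab
  refine congrFun (hm.range_inj strictMono_id |>.1 ?_) a
  rw [(Finite.injective_iff_surjective.1 hm.injective).range_eq, Set.range_id]

/-- The counit property of the coproduct. -/
theorem coprod_zero_right {n : ℕ} (x : RawTree ν n) (α : RTree (Fin n)) (β : RTree (Fin 0)) :
    coprod ν n 0 x α β = x α := by
  classical
  have hc : ∀ (τ : RTree (Fin n)) (I : Finset (Fin n))
      (h : (τ.branches I).card = n ∧ (τ.branches I)ᶜ.card = 0),
      τ.comap (Function.Embedding.inl.trans (branchEquiv h).toEmbedding) = τ := by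
    intro τ I h
    ext a b
    show τ.le (branchEquiv h (Sum.inl a)) (branchEquiv h (Sum.inl b)) ↔ _
    rw [branchEquiv_inl_of_univ, branchEquiv_inl_of_univ]
  unfold coprod
  -- The second factor is empty, so only the set of all children of the root survives, and its
  -- enumeration is the identity.
  refine (Finset.sum_eq_single (ι := RTree (Fin (n + 0))) α ?_ ?_).trans
    ((Finset.sum_eq_single (RTree.roots (ι := Fin (n + 0)) α) ?_ ?_).trans ?_)
  rotate_left 4
  · have h : (RTree.branches (ι := Fin (n + 0)) α α.roots).card = n ∧
        (RTree.branches (ι := Fin (n + 0)) α α.roots)ᶜ.card = 0 := by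
      have : RTree.branches (ι := Fin (n + 0)) α α.roots = Finset.univ := α.branches_roots
      rw [this]
      simp
    rw [dif_pos h, if_pos ⟨hc α _ h, Subsingleton.elim _ _⟩]
    refine permC_eq_self (n := n + 0) (fun i => ?_) _
    rw [Equiv.trans_apply]
    have : (finSumEquivOfFinset h.1 h.2).symm i = Sum.inl i := by
      rw [Equiv.symm_apply_eq]
      exact (branchEquiv_inl_of_univ (n := n) h i).symm
    rw [this]
    rfl
  · intro τ _ hne
    refine Finset.sum_eq_zero fun I _ => ?_
    split_ifs with h h'
    · exact (hne ((hc τ I h).symm.trans h'.1)).elim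
    · rfl
    · rfl
  · exact fun h => (h (Finset.mem_univ _)).elim
  · intro I hI hne
    rw [dif_neg]
    rintro ⟨h, -⟩
    refine hne (RTree.eq_roots_of_branches_eq_univ (Finset.mem_powerset.1 hI) ?_)
    rw [← Finset.card_eq_iff_eq_univ, h]
    simp
  · exact fun h => (h (Finset.mem_powerset_self _)).elim

/-- The completed zeroth tensor power is the line spanned by the empty tensor, and group-likeness
makes the coefficient idempotent. Coefficient 0 would force `g = 0` through the counit, so it is 1.
-/
theorem IsGroupLike.degree_zero {g : TreeAlg ν} (hg : IsGroupLike ν g) {N : ℕ}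
    (hν : ν.DominatesProjective N) (α : RTree (Fin 0)) :
    (g 0 : RawTree ν 0) α = pureC ν ![] := by
  obtain ⟨D, hD0, hD⟩ := hν.exists_bound
  obtain ⟨L, hL, -⟩ := exists_extension_of_bound ν hD0 zero_le_one (hD 0 (Nat.zero_le _))
    (B := fun _ : Fin 0 → E => (1 : ℝ)) (fun _ i => i.elim0) (fun e => by simp)
  have hid : ∀ a : CPow ν 0, a = L a • pureC ν ![] := by
    have : ContinuousLinearMap.id ℝ (CPow ν 0) = L.smulRight (pureC ν ![]) :=
      CPow.ext_pureC ν fun e => by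
        rw [ContinuousLinearMap.smulRight_apply, hL, one_smul, Subsingleton.elim e ![]]
        rfl
    exact fun a => congrArg (fun M => M a) this
  set a := (g 0 : RawTree ν 0) α with ha
  have hmul : a = mulC ν (k := 0) rfl a a := by
    rw [← hg.2 0 0 α α]
    exact (coprod_zero_right _ α α).symm
  have hp : mulC ν (k := 0) rfl (pureC ν ![]) (pureC ν ![]) = pureC ν ![] := by
    rw [mulC_pureC]
    congr 1
    exact Subsingleton.elim _ _
  have hsq : L a = L a * L a := by
    conv_lhs => rw [hmul, hid a]
    simp only [map_smul, smul_apply, hp, hL, smul_eq_mul, mul_one]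
  rcases eq_or_ne (L a) 0 with h | h
  · have ha0 : a = 0 := by rw [hid a, h, zero_smul]
    refine (hg.1 ?_).elim
    funext n
    refine Subtype.ext (funext fun τ => ?_)
    have := hg.2 n 0 τ α
    rw [← ha, ha0, map_zero] at this
    exact (coprod_zero_right _ τ α).symm.trans this
  · rw [hid a, mul_eq_left₀ h |>.1 hsq.symm, one_smul]

end Counit

/-! ### Reduction to trees whose root has one child -/

section Exponential

open RTree

variable {ν} {V : E → F → F} {q : F} {N : ℕ}

theorem RTree.card_roots_le {n : ℕ} (τ : RTree (Fin n)) : τ.roots.card ≤ n :=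
  (Finset.card_le_univ _).trans (by simp)

theorem RTree.card_roots_ne_zero {n : ℕ} (τ : RTree (Fin (n + 1))) : τ.roots.card ≠ 0 := by
  obtain ⟨r, hr, -⟩ := τ.exists_root_le 0
  exact Finset.card_ne_zero_of_mem hr

theorem primitivePart_zero (x : RawTree ν 0) : primitivePart ν V q x = 0 :=
  Finset.sum_eq_zero fun τ _ => by
    rw [extendMultilinear_forestVal_of_card_ne, zero_apply]
    have := τ.card_roots_le
    omega

theorem forestSum_degree_zero (hG : ForestExtends ν V q G N) {g : TreeAlg ν}
    (hg : IsGroupLike ν g) (hν : ν.DominatesProjective N) (A : F [×0]→L[ℝ] G) :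
    forestSum ν V q A (g 0 : RawTree ν 0) = A ![] := by
  let τ₀ : RTree (Fin 0) := ⟨fun _ _ => True, fun a => a.elim0, fun a => a.elim0,
    fun a => a.elim0, fun a => a.elim0⟩
  have hu : (Finset.univ : Finset (RTree (Fin 0))) = {τ₀} := by
    ext τ
    simpa using Subsingleton.elim _ _
  have hτ : τ₀.roots.card = 0 := Nat.le_zero.1 τ₀.card_roots_le
  rw [forestSum, hu, Finset.sum_singleton, hg.degree_zero hν, hG 0 (Nat.zero_le _), forestVal,
    dif_pos hτ]
  congr 1
  exact Subsingleton.elim _ _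

/-- The index type depends on `N` only, so that degrees can be collected into tuples in `Fin k → Fin
(N + 1)` during the induction on `k`. -/
theorem sum_antidiagonal_eq_sum_fin {M : Type*} [AddCommMonoid M] {n N : ℕ} (hn : n ≤ N)
    (f : ℕ → ℕ → M) :
    ∑ ml ∈ Finset.HasAntidiagonal.antidiagonal n, f ml.1 ml.2
      = ∑ m : Fin (N + 1), if (m : ℕ) ≤ n then f m (n - m) else 0 := by
  rw [Finset.Nat.sum_antidiagonal_eq_sum_range_succ f,
    Fin.sum_univ_eq_sum_range (fun m => if m ≤ n then f m (n - m) else 0), ← Finset.sum_filter]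
  refine Finset.sum_congr ?_ fun _ _ => rfl
  ext m
  simp only [Finset.mem_range, Finset.mem_filter]
  omega

/-- Elementary differentials of a group-like element are determined by the trees whose root has
exactly one child. -/
theorem factorial_smul_forestSum (hG : ForestExtends ν V q G N) (hF : ForestExtends ν V q F N)
    (hV : ∀ e, ContDiff ℝ (⊤ : ℕ∞) (V e)) {g : TreeAlg ν} (hg : IsGroupLike ν g)
    (hν : ν.DominatesProjective N) (k : ℕ) : ∀ n ≤ N, ∀ A : F [×k]→L[ℝ] G, A.IsSymm →
    (k.factorial : ℝ) • forestSum ν V q A (g n : RawTree ν n)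
      = ∑ c : Fin k → Fin (N + 1), if ∑ i, (c i : ℕ) = n then
          A (fun i => primitivePart ν V q (g (c i) : RawTree ν (c i))) else 0 := by
  induction k with
  | zero =>
    intro n hn A _
    rw [Nat.factorial_zero, Nat.cast_one, one_smul, Fintype.sum_unique]
    cases n with
    | zero =>
      rw [forestSum_degree_zero hG hg hν, if_pos (by simp)]
      congr 1
      exact Subsingleton.elim _ _
    | succ n =>
      rw [if_neg (by simp)]
      exact Finset.sum_eq_zero fun τ _ => by
        rw [extendMultilinear_forestVal_of_card_ne τ.card_roots_ne_zero, zero_apply]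
  | succ k ih =>
    intro n hn A hA
    -- The factor `k + 1` of the factorial is absorbed by the derivation property, which moves one
    -- branch of degree `m` into the first slot. The induction hypothesis treats the curried map in
    -- degree `n - m`, and `Fin.consEquiv` reassembles the degrees.
    rw [Nat.factorial_succ, Nat.cast_mul, mul_comm, mul_smul, Nat.cast_succ,
      ← sum_antidiagonal_forestSum hG hF hV hg hn hA, Finset.smul_sum,
      Finset.sum_congr rfl fun ml hml => ih ml.2
        ((Finset.HasAntidiagonal.antidiagonal.snd_le hml).trans hn) _ (hA.curryLeft _),
      sum_antidiagonal_eq_sum_fin hn (fun m l => ∑ c : Fin k → Fin (N + 1),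
        if ∑ i, (c i : ℕ) = l then (A.curryLeft (primitivePart ν V q (g m : RawTree ν m)))
          (fun i => primitivePart ν V q (g (c i) : RawTree ν (c i))) else 0),
      ← (Fin.consEquiv fun _ : Fin (k + 1) => Fin (N + 1)).sum_comp, Fintype.sum_prod_type]
    refine Finset.sum_congr rfl fun m _ => ?_
    have hA' : ∀ c : Fin k → Fin (N + 1),
        A.curryLeft (primitivePart ν V q (g m : RawTree ν m))
          (fun i => primitivePart ν V q (g (c i) : RawTree ν (c i)))
        = A fun i => primitivePart ν V q (g ((Fin.cons m c : Fin (k + 1) → Fin (N + 1)) i) :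
            RawTree ν ((Fin.cons m c : Fin (k + 1) → Fin (N + 1)) i)) := by
      intro c
      rw [ContinuousMultilinearMap.curryLeft_apply]
      congr 1
      funext i
      refine Fin.cases ?_ (fun i => ?_) i <;> rfl
    split_ifs with hmn
    · refine Finset.sum_congr rfl fun c _ => ?_
      rw [hA' c]
      refine if_congr ?_ rfl rfl
      simp only [Fin.consEquiv_apply, Fin.sum_univ_succ, Fin.cons_zero, Fin.cons_succ]
      omega
    · symm
      refine Finset.sum_eq_zero fun c _ => if_neg ?_
      simp only [Fin.consEquiv_apply, Fin.sum_univ_succ, Fin.cons_zero, Fin.cons_succ]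
      omega

/-- The truncated exponential series of the primitive part agrees with the elementary differentials
of a group-like element up to terms of degree larger than `N`. -/
theorem norm_sum_primitivePart_sub_forestSum_le (hG : ForestExtends ν V q G N)
    (hF : ForestExtends ν V q F N) (hV : ∀ e, ContDiff ℝ (⊤ : ℕ∞) (V e)) {g : TreeAlg ν}
    (hg : IsGroupLike ν g) (hν : ν.DominatesProjective N) {A : ∀ k : ℕ, F [×k]→L[ℝ] G}
    (hA : ∀ k, (A k).IsSymm) {M B h : ℝ} (hM : ∀ k ≤ N, ‖A k‖ ≤ M) (hB : 0 ≤ B) (hh : 0 ≤ h)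
    (hh1 : h ≤ 1) (hz : ∀ n ≤ N, ‖primitivePart ν V q (g n : RawTree ν n)‖ ≤ B * h ^ n) :
    ‖∑ k ∈ Finset.range (N + 1), (k.factorial : ℝ)⁻¹ • A k (fun _ =>
        ∑ n ∈ Finset.range (N + 1), primitivePart ν V q (g n : RawTree ν n))
      - ∑ n ∈ Finset.range (N + 1), ∑ k ∈ Finset.range (N + 1),
          forestSum ν V q (A k) (g n : RawTree ν n)‖
      ≤ (∑ k ∈ Finset.range (N + 1), (N + 1) ^ k * (M * B ^ k)) * h ^ (N + 1) := by
  have hM0 : 0 ≤ M := (norm_nonneg _).trans (hM 0 (Nat.zero_le _))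
  rw [Finset.sum_comm, ← Finset.sum_sub_distrib, Finset.sum_mul]
  refine norm_sum_le_of_le _ fun k hk => ?_
  rw [Finset.mem_range, Nat.lt_succ_iff] at hk
  have hf : (k.factorial : ℝ) ≠ 0 := by positivity
  have h₁ : ∀ n ∈ Finset.range (N + 1), forestSum ν V q (A k) (g n : RawTree ν n)
      = (k.factorial : ℝ)⁻¹ • ∑ c : Fin k → Fin (N + 1), if ∑ i, (c i : ℕ) = n then
          A k (fun i => primitivePart ν V q (g (c i) : RawTree ν (c i))) else 0 := by
    intro n hn
    rw [← factorial_smul_forestSum hG hF hV hg hν k n (by simpa [Nat.lt_succ_iff] using hn) _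
      (hA k), inv_smul_smul₀ hf]
  have h₂ : (A k fun _ => ∑ n ∈ Finset.range (N + 1), primitivePart ν V q (g n : RawTree ν n))
      = ∑ c : Fin k → Fin (N + 1),
          A k (fun i => primitivePart ν V q (g (c i) : RawTree ν (c i))) := by
    rw [← (A k).map_sum fun (_ : Fin k) (n : Fin (N + 1)) =>
      primitivePart ν V q (g n : RawTree ν n)]
    congr 1
    funext i
    rw [Fin.sum_univ_eq_sum_range (fun n => primitivePart ν V q (g n : RawTree ν n))]
  rw [Finset.sum_congr rfl h₁, ← Finset.smul_sum, ← smul_sub, norm_smul, h₂, Finset.sum_comm,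
    ← Finset.sum_sub_distrib]
  have hf1 : ‖(k.factorial : ℝ)⁻¹‖ ≤ 1 := by
    rw [norm_inv, Real.norm_natCast]
    exact inv_le_one_of_one_le₀ (by exact_mod_cast k.factorial_pos)
  refine (mul_le_of_le_one_left (norm_nonneg _) hf1).trans ?_
  refine (norm_sum_le _ _).trans ((Finset.sum_le_sum
    (g := fun _ : Fin k → Fin (N + 1) => M * B ^ k * h ^ (N + 1)) fun c _ => ?_).trans (le_of_eq ?_))
  -- Tuples of total degree at most `N` cancel. Each of the others is at most a multiple of `h ^ (N
  -- + 1)` because `h ≤ 1`, and there are at most `(N + 1) ^ k` of them.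
  · rw [Finset.sum_ite_eq]
    split_ifs with hc
    · rw [sub_self, norm_zero]
      positivity
    · rw [sub_zero]
      refine ((A k).le_opNorm _).trans ?_
      rw [mul_assoc]
      refine mul_le_mul (hM k hk) ?_ (by positivity) hM0
      have : ∏ i, ‖primitivePart ν V q (g (c i) : RawTree ν (c i))‖
          ≤ ∏ i, B * h ^ (c i : ℕ) :=
        Finset.prod_le_prod (fun _ _ => norm_nonneg _) fun i _ => hz _ (by omega)
      refine this.trans ?_
      rw [Finset.prod_mul_distrib, Finset.prod_const, Finset.card_univ, Fintype.card_fin,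
        Finset.prod_pow_eq_pow_sum]
      refine mul_le_mul_of_nonneg_left (pow_le_pow_of_le_one hh hh1 ?_) (by positivity)
      simpa using hc
  · rw [Finset.sum_const, Finset.card_univ, Fintype.card_fun, Fintype.card_fin, Fintype.card_fin,
      nsmul_eq_mul]
    push_cast
    ring

end Exponential

/-! ### Uniform estimates over compact sets of base points -/

open RTree

theorem exists_forestExtends_of_isCompact [CompleteSpace E] [CompleteSpace G] {V : E → F → F}
    (hVlin : ∀ q, IsLinearMap ℝ fun e => V e q) (hV : ∀ e, ContDiff ℝ (⊤ : ℕ∞) (V e))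
    (hVcont : ∀ q, Continuous fun e => V e q) {N : ℕ} (hν : ν.DominatesProjective N)
    {K : Set F} (hK : IsCompact K) :
    ∃ B, 0 ≤ B ∧ ∀ q ∈ K, ForestExtends ν V q G N ∧
      ∀ (k : ℕ) (A : F [×k]→L[ℝ] G), ∀ n ≤ N, ∀ x : TreeSpace ν n,
        ‖forestSum ν V q A (x : RawTree ν n)‖ ≤ ‖A‖ * B * treeNorm ν x := by
  obtain ⟨C, hC0, hC⟩ := exists_bound_iteratedFDeriv_le hVlin hV hVcont hK N
  obtain ⟨D, hD0, hD⟩ := hν.exists_bound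
  have key : ∀ q ∈ K, ∀ n ≤ N, ∀ (τ : RTree (Fin n)) (k : ℕ) (A : F [×k]→L[ℝ] G),
      ∃ L : CPow ν n →L[ℝ] G, (∀ e, L (pureC ν e) = τ.forestVal V q A e) ∧
        ‖L‖ ≤ ‖A‖ * C ^ n * D := fun q hq n hn τ k A =>
    exists_extension_of_bound ν hD0 (by positivity) (hD n hn)
      (isLinearMap_forestVal hV (isLinearMap_iteratedFDeriv hVlin hV q) A)
      (norm_forestVal_le hV hn (hC q hq) hC0 A)
  -- The maximum with 1 makes the `N`-th power dominate `C ^ n` for every `n ≤ N`.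
  refine ⟨max 1 C ^ N * D, by positivity, fun q hq => ⟨fun n hn τ k A e => ?_,
    fun k A n hn x => ?_⟩⟩
  · obtain ⟨L, hL, -⟩ := key q hq n hn τ k A
    rw [extendMultilinear_eq ν hL, hL]
  · rw [treeNorm, Finset.mul_sum]
    refine norm_sum_le_of_le _ fun τ _ => ?_
    obtain ⟨L, hL, hLn⟩ := key q hq n hn τ k A
    rw [extendMultilinear_eq ν hL]
    refine L.le_of_opNorm_le (hLn.trans ?_) _
    rw [mul_assoc]
    gcongr
    exact (pow_le_pow_left₀ hC0 (le_max_right _ _) n).trans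
      (pow_le_pow_right₀ (le_max_left _ _) hn)

/-- Taylor's formula with a remainder estimate that is uniform over compact sets. -/
theorem exists_taylor_bound_of_isCompact [CompleteSpace G] {f : F → G} {U : Set F} (hU : IsOpen U)
    (hf : ContDiffOn ℝ (⊤ : ℕ∞) f U) {K : Set F} (hK : IsCompact K) (hKU : K ⊆ U) (N : ℕ) :
    ∃ δ M, 0 < δ ∧ 0 ≤ M ∧ ∀ q ∈ K, (∀ k ≤ N, ‖iteratedFDeriv ℝ k f q‖ ≤ M) ∧
      ∀ z, ‖z‖ ≤ δ → q + z ∈ U ∧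
        ‖f (q + z) - ∑ k ∈ Finset.range (N + 1),
          (k.factorial : ℝ)⁻¹ • iteratedFDeriv ℝ k f q (fun _ => z)‖ ≤ M * ‖z‖ ^ (N + 1) := by
  let b : F → ℝ := fun p => ∑ k ∈ Finset.range (N + 2), ‖iteratedFDeriv ℝ k f p‖
  have hb : ContinuousOn b U := continuousOn_finsetSum _ fun k _ p hp =>
    ((hU.contDiffAt_of_contDiffOn hf hp).differentiableAt_iteratedFDeriv_top
      k).continuousAt.norm.continuousWithinAt
  obtain ⟨M, hM⟩ := hK.exists_bound_of_continuousOn (hb.mono hKU)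
  have hS : IsOpen (U ∩ b ⁻¹' Set.Iio (max M 0 + 1)) := hb.isOpen_inter_preimage hU isOpen_Iio
  have hKS : K ⊆ U ∩ b ⁻¹' Set.Iio (max M 0 + 1) := fun q hq => ⟨hKU hq, by
    have := (le_abs_self _).trans (hM q hq)
    have := le_max_left M 0
    simp only [Set.mem_preimage, Set.mem_Iio]
    linarith⟩
  -- A closed neighbourhood of `K` need not be compact, so the derivative bound is kept by staying
  -- in the open set where `b` is below a fixed level.
  obtain ⟨δ, hδ, hδS⟩ := hK.exists_cthickening_subset_open hS hKS
  have hbd : ∀ p ∈ U ∩ b ⁻¹' Set.Iio (max M 0 + 1), ∀ k ≤ N + 1,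
      ‖iteratedFDeriv ℝ k f p‖ ≤ max M 0 + 1 := fun p hp k hk =>
    (Finset.single_le_sum (f := fun k => ‖iteratedFDeriv ℝ k f p‖) (fun _ _ => norm_nonneg _)
      (Finset.mem_range.2 (by omega))).trans (le_of_lt hp.2)
  refine ⟨δ, max M 0 + 1, hδ, by positivity, fun q hq => ⟨fun k hk => hbd q (hKS hq) k (by omega),
    fun z hz => ?_⟩⟩
  have hseg : ∀ t ∈ Set.Icc (0 : ℝ) 1, q + t • z ∈ U ∩ b ⁻¹' Set.Iio (max M 0 + 1) := by
    intro t ht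
    refine hδS (Metric.mem_cthickening_of_dist_le _ q _ _ hq ?_)
    rw [dist_eq_norm, add_sub_cancel_left, norm_smul, Real.norm_of_nonneg ht.1]
    exact (mul_le_of_le_one_left (norm_nonneg _) ht.2).trans hz
  refine ⟨by simpa using (hseg 1 ⟨zero_le_one, le_rfl⟩).1, ?_⟩
  rw [map_add_eq_sum_add_integral_iteratedFDeriv (n := N) fun t ht =>
    (hU.contDiffAt_of_contDiffOn hf (hseg t ht).1).of_le (WithTop.coe_le_coe.2 le_top),
    add_sub_cancel_left, norm_smul]
  have hf1 : ‖(N.factorial : ℝ)⁻¹‖ ≤ 1 := by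
    rw [norm_inv, Real.norm_natCast]
    exact inv_le_one_of_one_le₀ (by exact_mod_cast N.factorial_pos)
  refine (mul_le_of_le_one_left (norm_nonneg _) hf1).trans ?_
  refine (intervalIntegral.norm_integral_le_of_norm_le_const fun t ht => ?_).trans_eq
    (by rw [sub_zero, abs_one, mul_one])
  rw [Set.uIoc_of_le zero_le_one] at ht
  have h₁ : ‖(1 - t) ^ N‖ ≤ 1 := by
    rw [norm_pow, Real.norm_of_nonneg (by linarith [ht.2])]
    exact pow_le_one₀ (by linarith [ht.2]) (by linarith [ht.1])
  rw [norm_smul]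
  refine (mul_le_of_le_one_left (norm_nonneg _) h₁).trans
    ((ContinuousMultilinearMap.le_opNorm _ _).trans ?_)
  rw [Finset.prod_const, Finset.card_univ, Fintype.card_fin]
  exact mul_le_mul_of_nonneg_right (hbd _ (hseg t ⟨ht.1.le, ht.2⟩) _ le_rfl) (by positivity)

/-- Taylor's formula of order 0. Only one of the two points has to lie in `K`, as needed for
comparing a point of the path with its approximation. -/
theorem exists_lipschitz_of_isCompact [CompleteSpace G] {f : F → G} {U : Set F} (hU : IsOpen U)
    (hf : ContDiffOn ℝ (⊤ : ℕ∞) f U) {K : Set F} (hK : IsCompact K) (hKU : K ⊆ U) :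
    ∃ δ L, 0 < δ ∧ 0 ≤ L ∧ ∀ a ∈ K, ∀ b, ‖b - a‖ ≤ δ → ‖f b - f a‖ ≤ L * ‖b - a‖ := by
  obtain ⟨δ, M, hδ, hM, h⟩ := exists_taylor_bound_of_isCompact hU hf hK hKU 0
  refine ⟨δ, M, hδ, hM, fun a ha b hb => ?_⟩
  simpa using ((h a ha).2 _ hb).2

/-! ### Elementary differentials and the change of variables formula -/

section ChangeOfVariables

variable {ν} {V : E → F → F} {q : F} {N : ℕ}

/-- A tree contributes only for `k` equal to its number of children of the root. -/
theorem sum_forestSum_eq (A : ∀ k : ℕ, F [×k]→L[ℝ] G) {n : ℕ} (hn : n ≤ N) (x : RawTree ν n) :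
    ∑ k ∈ Finset.range (N + 1), forestSum ν V q (A k) x
      = ∑ τ : RTree (Fin n), extendMultilinear ν (τ.forestVal V q (A τ.roots.card)) (x τ) := by
  unfold forestSum
  rw [Finset.sum_comm]
  refine Finset.sum_congr rfl fun τ _ => ?_
  rw [Finset.sum_eq_single τ.roots.card]
  · intro k _ hk
    rw [extendMultilinear_forestVal_of_card_ne hk.symm, zero_apply]
  · intro h
    have := τ.card_roots_le
    exact (h (Finset.mem_range.2 (by omega))).elim

/-- Moves the increment in the new coordinates back to `q`, with `φ` at the root and ordinary
derivatives everywhere. -/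
theorem elemDiff_pushforward {φ : OpenPartialHomeomorph F F}
    (hφ : ContDiffOn ℝ (⊤ : ℕ∞) φ φ.source) (hφ' : ContDiffOn ℝ (⊤ : ℕ∞) φ.symm φ.target)
    (hV : ∀ e, ContDiff ℝ (⊤ : ℕ∞) (V e)) (hq : q ∈ φ.source) (x : TreeAlg ν) :
    elemDiff ν N (pushforwardConnection φ) (fun e => pushforwardField φ (V e)) id (φ q) x
      = ∑ n ∈ Finset.range (N + 1), ∑ k ∈ Finset.range (N + 1),
          forestSum ν V q (iteratedFDeriv ℝ k φ q) (x n : RawTree ν n) := by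
  refine Finset.sum_congr rfl fun n hn => ?_
  rw [sum_forestSum_eq (fun k => iteratedFDeriv ℝ k φ q)
    (Nat.lt_succ_iff.1 (Finset.mem_range.1 hn))]
  refine Finset.sum_congr rfl fun τ _ => ?_
  congr 2
  exact funext fun e => treeVal_pushforward hφ hφ' hV hq e

theorem elemDiff_canonical (x : TreeAlg ν) :
    elemDiff ν N canonicalConnection V id q x
      = ∑ n ∈ Finset.range (N + 1), ∑ k ∈ Finset.range (N + 1),
          forestSum ν V q (iteratedFDeriv ℝ k id q) (x n : RawTree ν n) := by
  refine Finset.sum_congr rfl fun n hn => ?_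
  rw [sum_forestSum_eq (fun k => iteratedFDeriv ℝ k id q)
    (Nat.lt_succ_iff.1 (Finset.mem_range.1 hn))]
  refine Finset.sum_congr rfl fun τ _ => ?_
  congr 2
  exact funext fun e => treeVal_canonical_id e

theorem iteratedFDeriv_one_id : iteratedFDeriv ℝ 1 (id : F → F) q = idOne := by
  ext w
  simp [idOne_apply]

theorem iteratedFDeriv_add_two_id (k : ℕ) : iteratedFDeriv ℝ (k + 2) (id : F → F) q = 0 := by
  ext w
  rw [iteratedFDeriv_succ_apply_right]
  simp only [fderiv_id]
  rw [iteratedFDeriv_const_of_ne (by omega)]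
  simp

/-- The elementary differential of the identity for the canonical connection. -/
theorem elemDiff_canonical_eq (hF : ForestExtends ν V q F N)
    (hN : 1 ≤ N) {g : TreeAlg ν} (hg : IsGroupLike ν g)
    (hν : ν.DominatesProjective N) :
    elemDiff ν N canonicalConnection V id q (trunc ν N g)
      = q + ∑ n ∈ Finset.range (N + 1), primitivePart ν V q (g n : RawTree ν n) := by
  obtain ⟨N, rfl⟩ : ∃ N', N = N' + 1 := ⟨N - 1, by omega⟩
  have ht : ∀ n ∈ Finset.range (N + 1 + 1), trunc ν (N + 1) g n = g n := fun n hn => by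
    rw [trunc, if_pos (Nat.lt_succ_iff.1 (Finset.mem_range.1 hn))]
  have h₀ : ∑ n ∈ Finset.range (N + 1 + 1), forestSum ν V q (iteratedFDeriv ℝ 0 id q)
      (trunc ν (N + 1) g n : RawTree ν n) = q := by
    rw [Finset.sum_eq_single_of_mem 0 (by simp), ht 0 (by simp), forestSum_degree_zero hF hg hν]
    · rfl
    · intro n _ hn
      obtain ⟨n, rfl⟩ := Nat.exists_eq_succ_of_ne_zero hn
      exact Finset.sum_eq_zero fun τ _ => by
        rw [extendMultilinear_forestVal_of_card_ne τ.card_roots_ne_zero, zero_apply]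
  have h₁ : ∑ n ∈ Finset.range (N + 1 + 1), forestSum ν V q (iteratedFDeriv ℝ (0 + 1) id q)
      (trunc ν (N + 1) g n : RawTree ν n)
      = ∑ n ∈ Finset.range (N + 1 + 1), primitivePart ν V q (g n : RawTree ν n) :=
    Finset.sum_congr rfl fun n hn => by
      rw [ht n hn, zero_add, iteratedFDeriv_one_id]
      rfl
  have h₂ : ∑ k ∈ Finset.range N, ∑ n ∈ Finset.range (N + 1 + 1),
      forestSum ν V q (iteratedFDeriv ℝ (k + 1 + 1) id q)
        (trunc ν (N + 1) g n : RawTree ν n) = 0 :=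
    Finset.sum_eq_zero fun k _ => Finset.sum_eq_zero fun n _ => Finset.sum_eq_zero fun τ _ => by
      rw [iteratedFDeriv_add_two_id, extendMultilinear_forestVal_zero, zero_apply]
  -- The orders 0, 1 and at least 2 of the derivative of the identity give `q`, the primitive part
  -- and 0.
  rw [elemDiff_canonical, Finset.sum_comm, Finset.sum_range_succ', Finset.sum_range_succ', h₀, h₁,
    h₂, zero_add, add_comm]

theorem norm_pureC_zero : ‖pureC ν ![]‖ = 1 := by
  rw [pureC, norm_toCPow, TPow.norm_eq]
  exact ν.nrm_zero

/-- Change of variables for elementary differentials of group-like elements. -/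
theorem exists_elemDiff_pushforward_bound [CompleteSpace E] [CompleteSpace F]
    (hVlin : ∀ q, IsLinearMap ℝ fun e => V e q) (hV : ∀ e, ContDiff ℝ (⊤ : ℕ∞) (V e))
    (hVcont : ∀ q, Continuous fun e => V e q) (hN : 1 ≤ N) (hν : ν.DominatesProjective N)
    {φ : OpenPartialHomeomorph F F} (hφ : ContDiffOn ℝ (⊤ : ℕ∞) φ φ.source)
    (hφ' : ContDiffOn ℝ (⊤ : ℕ∞) φ.symm φ.target) {K : Set F} (hK : IsCompact K)
    (hKU : K ⊆ φ.source) :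
    ∃ δ C, 0 < δ ∧ 0 ≤ C ∧ ∀ q ∈ K, ∀ g, IsGroupLike ν g → ∀ h, 0 ≤ h → h ≤ δ →
      (∀ k, 1 ≤ k → k ≤ N → treeNorm ν (trunc ν N g k) ≤ h ^ k) →
      elemDiff ν N canonicalConnection V id q (trunc ν N g) ∈ φ.source ∧
      ‖φ (elemDiff ν N canonicalConnection V id q (trunc ν N g))
        - elemDiff ν N (pushforwardConnection φ) (fun e => pushforwardField φ (V e)) id (φ q)
          (trunc ν N g)‖ ≤ C * h ^ (N + 1) := by
  obtain ⟨B, hB0, hB⟩ := exists_forestExtends_of_isCompact (G := F) ν hVlin hV hVcont hν hK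
  obtain ⟨ε, M, hε, hM, hT⟩ := exists_taylor_bound_of_isCompact φ.open_source hφ hK hKU N
  set B' := ‖(idOne : F [×1]→L[ℝ] F)‖ * B with hB'
  have hB'0 : 0 ≤ B' := by positivity
  -- The first bound turns higher powers of `h` into smaller ones, the second keeps `z` within the
  -- radius `ε` of Taylor's formula; the added 1 avoids division by zero. The constant adds the
  -- Taylor remainder and the surplus of the exponential series.
  refine ⟨min 1 (ε / ((N + 1) * B' + 1)),
    M * ((N + 1) * B') ^ (N + 1)
      + ∑ k ∈ Finset.range (N + 1), (N + 1) ^ k * (M * B' ^ k), by positivity, by positivity,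
    fun q hq g hg h hh hhδ hb => ?_⟩
  have hh1 : h ≤ 1 := hhδ.trans (min_le_left _ _)
  obtain ⟨hF, hBq⟩ := hB q hq
  obtain ⟨hMq, hTq⟩ := hT q hq
  have ht : ∀ n ≤ N, trunc ν N g n = g n := fun n hn => by rw [trunc, if_pos hn]
  have hz : ∀ n ≤ N, ‖primitivePart ν V q (g n : RawTree ν n)‖ ≤ B' * h ^ n := by
    intro n hn
    rcases Nat.eq_zero_or_pos n with rfl | hn0
    · rw [primitivePart_zero, norm_zero]
      positivity
    · refine (hBq 1 idOne n hn (g n)).trans (mul_le_mul_of_nonneg_left ?_ hB'0)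
      rw [← ht n hn]
      exact hb n hn0 hn
  set z := ∑ n ∈ Finset.range (N + 1), primitivePart ν V q (g n : RawTree ν n) with hzdef
  have hznorm : ‖z‖ ≤ (N + 1) * B' * h := by
    refine (norm_sum_le_of_le (s := Finset.range (N + 1)) (n := fun _ => B' * h) fun n hn => ?_).trans
      (le_of_eq ?_)
    · rcases Nat.eq_zero_or_pos n with rfl | hn0
      · rw [primitivePart_zero, norm_zero]
        positivity
      · refine (hz n (Nat.lt_succ_iff.1 (Finset.mem_range.1 hn))).trans
          (mul_le_mul_of_nonneg_left ?_ hB'0)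
        exact pow_le_of_le_one hh hh1 (by omega)
    · rw [Finset.sum_const, Finset.card_range, nsmul_eq_mul]
      push_cast
      ring
  have hzε : ‖z‖ ≤ ε := by
    refine hznorm.trans ?_
    have h₁ : h ≤ ε / ((N + 1) * B' + 1) := hhδ.trans (min_le_right _ _)
    rw [le_div_iff₀ (by positivity)] at h₁
    nlinarith
  obtain ⟨hmem, hrem⟩ := hTq z hzε
  have hexp := norm_sum_primitivePart_sub_forestSum_le hF hF hV hg hν
    (A := fun k => iteratedFDeriv ℝ k φ q)
    (fun k => (φ.open_source.contDiffAt_of_contDiffOn hφ (hKU hq)).isSymm_iteratedFDeriv k)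
    hMq hB'0 hh hh1 hz
  rw [elemDiff_canonical_eq hF hN hg hν, elemDiff_pushforward hφ hφ' hV (hKU hq)]
  refine ⟨hmem, ?_⟩
  have hsum : ∑ n ∈ Finset.range (N + 1), ∑ k ∈ Finset.range (N + 1),
      forestSum ν V q (iteratedFDeriv ℝ k φ q) (trunc ν N g n : RawTree ν n)
      = ∑ n ∈ Finset.range (N + 1), ∑ k ∈ Finset.range (N + 1),
        forestSum ν V q (iteratedFDeriv ℝ k φ q) (g n : RawTree ν n) :=
    Finset.sum_congr rfl fun n hn => by rw [ht n (Nat.lt_succ_iff.1 (Finset.mem_range.1 hn))]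
  rw [hsum, add_mul]
  refine (norm_sub_le_norm_sub_add_norm_sub _ _ _).trans (add_le_add (hrem.trans ?_) hexp)
  rw [mul_assoc, ← mul_pow]
  exact mul_le_mul_of_nonneg_left (pow_le_pow_left₀ (norm_nonneg _) hznorm _) hM

/-- Elementary differentials are bounded on bounded sets of group-like elements. -/
theorem exists_elemDiff_bound [CompleteSpace E] [CompleteSpace F]
    (hVlin : ∀ q, IsLinearMap ℝ fun e => V e q) (hV : ∀ e, ContDiff ℝ (⊤ : ℕ∞) (V e))
    (hVcont : ∀ q, Continuous fun e => V e q) (hν : ν.DominatesProjective N)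
    {f : F → F} {U : Set F} (hU : IsOpen U) (hf : ContDiffOn ℝ (⊤ : ℕ∞) f U) {K : Set F}
    (hK : IsCompact K) (hKU : K ⊆ U) (H : ℝ) :
    ∃ R, ∀ q ∈ K, ∀ g, IsGroupLike ν g → ∀ h, 0 ≤ h → h ≤ H →
      (∀ k, 1 ≤ k → k ≤ N → treeNorm ν (trunc ν N g k) ≤ h ^ k) →
      ‖∑ n ∈ Finset.range (N + 1), ∑ k ∈ Finset.range (N + 1),
          forestSum ν V q (iteratedFDeriv ℝ k f q) (trunc ν N g n : RawTree ν n)‖ ≤ R := by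
  obtain ⟨B, hB0, hB⟩ := exists_forestExtends_of_isCompact (G := F) ν hVlin hV hVcont hν hK
  obtain ⟨ε, M, hε, hM, hT⟩ := exists_taylor_bound_of_isCompact hU hf hK hKU N
  refine ⟨∑ n ∈ Finset.range (N + 1), ∑ k ∈ Finset.range (N + 1),
    M * B * ((Fintype.card (RTree (Fin 0)) : ℝ) + H ^ n), fun q hq g hg h hh hH hb => ?_⟩
  refine norm_sum_le_of_le _ fun n hn => norm_sum_le_of_le _ fun k hk => ?_
  rw [Finset.mem_range, Nat.lt_succ_iff] at hn hk
  refine ((hB q hq).2 k _ n hn _).trans (mul_le_mul (mul_le_mul_of_nonneg_right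
    ((hT q hq).1 k hk) hB0) ?_ (Finset.sum_nonneg fun _ _ => norm_nonneg _) (by positivity))
  -- The assumed bounds start in degree 1; the degree 0 part is controlled by the normalisation of
  -- group-like elements.
  rcases Nat.eq_zero_or_pos n with rfl | hn0
  · have : treeNorm ν (trunc ν N g 0) = (Fintype.card (RTree (Fin 0)) : ℝ) := by
      rw [trunc, if_pos hn, treeNorm, Finset.sum_congr rfl fun τ _ =>
        (congrArg norm (hg.degree_zero hν τ)).trans norm_pureC_zero]
      simp
    rw [this, pow_zero]
    linarith
  · refine ((hb n hn0 hn).trans (pow_le_pow_left₀ hh hH n)).trans ?_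
    have : (0 : ℝ) ≤ Fintype.card (RTree (Fin 0)) := Nat.cast_nonneg _
    linarith

end ChangeOfVariables

/-! ### Transfer of error estimates -/

theorem isLittleO_abs_rpow {r : ℝ} (hr : 1 < r) :
    (fun h : ℝ => |h| ^ r) =o[𝓝 0] (fun h : ℝ => h) := by
  have h₁ : Filter.Tendsto (fun h : ℝ => |h| ^ (r - 1)) (𝓝 0) (𝓝 0) := by
    have : ContinuousAt (fun h : ℝ => |h| ^ (r - 1)) 0 :=
      (continuous_abs.rpow_const fun _ => Or.inr (by linarith)).continuousAt
    simpa [ContinuousAt, Real.zero_rpow (by linarith : r - 1 ≠ 0)] using this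
  have h₂ := ((Asymptotics.isLittleO_one_iff ℝ).2 h₁).mul_isBigO
    (Asymptotics.isBigO_refl (fun h : ℝ => |h|) (𝓝 0))
  have h₃ : (fun h : ℝ => |h| ^ r) = fun h : ℝ => |h| ^ (r - 1) * |h| := by
    funext h
    rcases eq_or_ne h 0 with rfl | hne
    · simp [Real.zero_rpow (by linarith : r ≠ 0)]
    · rw [← Real.rpow_add_one (abs_ne_zero.2 hne), sub_add_cancel]
  rw [h₃]
  exact Asymptotics.isLittleO_abs_right.1 (by simpa using h₂)

/-- Near 0 the new error function is `L * (θ + ρ)`. Elsewhere it may be the constant `R`, since the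
little-o condition only concerns a neighbourhood of 0. -/
theorem exists_isLittleO_of_local_bound {ι : Type*} {S : Set ι} {w e e' : ι → ℝ} {ρ : ℝ → ℝ}
    (hρ : ρ =o[𝓝 0] (fun h : ℝ => h)) {δ L R : ℝ} (hδ : 0 < δ)
    (hL : 0 ≤ L)
    (hloc : ∀ i ∈ S, w i ≤ δ → e i ≤ δ → ρ (w i) ≤ δ → e' i ≤ L * (e i + ρ (w i)))
    (hR : ∀ i ∈ S, e' i ≤ R)
    (h : ∃ θ : ℝ → ℝ, θ =o[𝓝 0] (fun h : ℝ => h) ∧ ∀ i ∈ S, e i ≤ θ (w i)) :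
    ∃ θ : ℝ → ℝ, θ =o[𝓝 0] (fun h : ℝ => h) ∧ ∀ i ∈ S, e' i ≤ θ (w i) := by
  obtain ⟨θ, hθ, hle⟩ := h
  have hsmall : ∀ f : ℝ → ℝ, f =o[𝓝 0] (fun h : ℝ => h) → ∀ᶠ h in 𝓝 0, f h < δ := by
    intro f hf
    have : Filter.Tendsto f (𝓝 0) (𝓝 0) := hf.isBigO.trans_tendsto Filter.tendsto_id
    exact this.eventually_lt_const hδ
  obtain ⟨ε, hε, hball⟩ := Metric.eventually_nhds_iff.1
    (((hsmall θ hθ).and (hsmall ρ hρ)).and (eventually_lt_nhds hδ))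
  classical
  refine ⟨fun h => if |h| < ε then L * (θ h + ρ h) else R, ?_, fun i hi => ?_⟩
  · refine ((hθ.add hρ).const_mul_left L).congr' ?_ Filter.EventuallyEq.rfl
    filter_upwards [Metric.ball_mem_nhds (0 : ℝ) hε] with h hh
    rw [if_pos (by simpa using hh)]
  · simp only
    split_ifs with hlt
    · obtain ⟨⟨h₁, h₂⟩, h₃⟩ := hball (y := w i) (by simpa using hlt)
      refine (hloc i hi h₃.le ((hle i hi).trans h₁.le) h₂.le).trans ?_
      have := hle i hi
      gcongr
    · exact hR i hi

/-! ### Coordinate invariance of rough differential equations -/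

theorem solvesRDE_iff {p T : ℝ} {ω : ℝ → ℝ → ℝ} {x : ℝ → ℝ → TreeAlg ν}
    {nabla : (F → F) → (F → F) → F → F} {V : E → F → F} {y : ℝ → F} :
    SolvesRDE ν p T ω x nabla V y ↔ ∃ θ : ℝ → ℝ, θ =o[𝓝 0] (fun h : ℝ => h) ∧
      ∀ i ∈ simplex T, ‖y i.2 - elemDiff ν ⌊p⌋₊ nabla V id (y i.1) (x i.1 i.2)‖
        ≤ θ (ω i.1 i.2) :=
  exists_congr fun _ => and_congr_right fun _ =>
    ⟨fun h i hi => h i.1 i.2 hi.1 hi.2.1 hi.2.2, fun h s t h₁ h₂ h₃ => h (s, t) ⟨h₁, h₂, h₃⟩⟩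

theorem IsControl.le_total {T : ℝ} {ω : ℝ → ℝ → ℝ} (hω : IsControl T ω) {s t : ℝ} (hs : 0 ≤ s)
    (hst : s ≤ t) (ht : t ≤ T) : ω s t ≤ ω 0 T := by
  have h₁ := hω.superadd 0 s T le_rfl hs (hst.trans ht) le_rfl
  have h₂ := hω.superadd s t T hs hst ht le_rfl
  have h₃ := hω.nonneg 0 s le_rfl hs (hst.trans ht)
  have h₄ := hω.nonneg t T (hs.trans hst) ht le_rfl
  linarith

end

/-! ### Proof of the coordinate invariance -/

theorem mainTheorem7
    {E F : Type*} [NormedAddCommGroup E] [NormedSpace ℝ E] [CompleteSpace E]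
    [NormedAddCommGroup F] [NormedSpace ℝ F] [CompleteSpace F]
    (ν : SymmCrossNorm E) (p T : ℝ) (hp : 1 ≤ p) (hT : 0 < T)
    (hν : ν.DominatesProjective ⌊p⌋₊)
    (V : E → F → F) (hVcont : Continuous fun q : E × F => V q.1 q.2)
    (hVlin : ∀ q, IsLinearMap ℝ fun e => V e q) (hVsmooth : ∀ e, ContDiff ℝ (⊤ : ℕ∞) (V e))
    (ω : ℝ → ℝ → ℝ) (hω : IsControl T ω)
    (x : ℝ → ℝ → TreeAlg ν) (hx : IsBranchedRoughPath ν p T ω x)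
    (φ : OpenPartialHomeomorph F F) (hφ : ContDiffOn ℝ (⊤ : ℕ∞) φ φ.source)
    (hφ' : ContDiffOn ℝ (⊤ : ℕ∞) φ.symm φ.target)
    (y : ℝ → F) (hy : ContinuousOn y (Set.Icc 0 T))
    (hyU : ∀ t ∈ Set.Icc 0 T, y t ∈ φ.source) :
    SolvesRDE ν p T ω x canonicalConnection V y ↔
      SolvesRDE ν p T ω x (pushforwardConnection φ) (fun e => pushforwardField φ (V e))
        (fun t => φ (y t)) := by
  have hp0 : 0 < p := zero_lt_one.trans_le hp
  set N := ⌊p⌋₊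
  have hN : 1 ≤ N := Nat.le_floor (by exact_mod_cast hp)
  -- This exponent above 1 makes the change of variables error `o(ω)`.
  have hr : 1 < ((N + 1 : ℕ) : ℝ) / p := by
    rw [one_lt_div hp0]
    push_cast
    exact Nat.lt_floor_add_one p
  have hVc : ∀ q, Continuous fun e => V e q := fun q => hVcont.comp (Continuous.prodMk_left q)
  set K := y '' Set.Icc 0 T
  have hK : IsCompact K := isCompact_Icc.image_of_continuousOn hy
  have hKU : K ⊆ φ.source := by
    rintro _ ⟨t, ht, rfl⟩
    exact hyU t ht
  have hK' : IsCompact (φ '' K) := hK.image_of_continuousOn (φ.continuousOn.mono hKU)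
  have hKU' : φ '' K ⊆ φ.target := by
    rintro _ ⟨q, hq, rfl⟩
    exact φ.map_source (hKU hq)
  have hsK : ∀ i ∈ simplex T, y i.1 ∈ K := fun i hi => ⟨i.1, ⟨hi.1, hi.2.1.trans hi.2.2⟩, rfl⟩
  have htK : ∀ i ∈ simplex T, y i.2 ∈ K := fun i hi => ⟨i.2, ⟨hi.1.trans hi.2.1, hi.2.2⟩, rfl⟩
  have hω0 : ∀ i ∈ simplex T, 0 ≤ ω i.1 i.2 := fun i hi => hω.nonneg _ _ hi.1 hi.2.1 hi.2.2
  have hpow : ∀ i ∈ simplex T, ∀ k : ℕ, (ω i.1 i.2 ^ (1 / p)) ^ k = ω i.1 i.2 ^ ((k : ℝ) / p) :=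
    fun i hi k => by
      rw [← Real.rpow_mul_natCast (hω0 i hi)]
      congr 1
      ring
  -- The homogeneous size of the increment is `h = ω ^ (1 / p)`; accordingly the threshold `h ≤ δ`
  -- becomes `ω ≤ δ ^ p` below.
  have hgl : ∀ i ∈ simplex T, ∃ g, IsGroupLike ν g ∧ x i.1 i.2 = trunc ν N g ∧
      ∀ k, 1 ≤ k → k ≤ N → treeNorm ν (trunc ν N g k) ≤ (ω i.1 i.2 ^ (1 / p)) ^ k := by
    intro i hi
    obtain ⟨g, hg, hxg⟩ := hx.groupLike _ _ hi.1 hi.2.1 hi.2.2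
    refine ⟨g, hg, hxg, fun k hk hkN => ?_⟩
    rw [hpow i hi, ← hxg]
    exact hx.bound _ _ hi.1 hi.2.1 hi.2.2 k hk hkN
  obtain ⟨δ, C, hδ, hC, hloc⟩ := exists_elemDiff_pushforward_bound hVlin hVsmooth hVc hN hν hφ hφ'
    hK hKU
  obtain ⟨δ₁, L₁, hδ₁, hL₁, hLip₁⟩ := exists_lipschitz_of_isCompact φ.open_source hφ hK hKU
  obtain ⟨δ₂, L₂, hδ₂, hL₂, hLip₂⟩ := exists_lipschitz_of_isCompact φ.open_target hφ' hK' hKU'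
  obtain ⟨R₁, hR₁⟩ := exists_elemDiff_bound (N := N) hVlin hVsmooth hVc hν isOpen_univ
    (contDiff_id.contDiffOn) hK (Set.subset_univ _) (ω 0 T ^ (1 / p))
  obtain ⟨R₂, hR₂⟩ := exists_elemDiff_bound (N := N) hVlin hVsmooth hVc hν φ.open_source hφ
    hK hKU (ω 0 T ^ (1 / p))
  obtain ⟨S₁, hS₁⟩ := hK.exists_bound_of_continuousOn (f := id) continuousOn_id
  obtain ⟨S₂, hS₂⟩ := hK'.exists_bound_of_continuousOn (f := id) continuousOn_id
  set Ψ : ℝ × ℝ → F := fun i => elemDiff ν N canonicalConnection V id (y i.1) (x i.1 i.2) with hΨ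
  set Ψ' : ℝ × ℝ → F := fun i => elemDiff ν N (pushforwardConnection φ)
    (fun e => pushforwardField φ (V e)) id (φ (y i.1)) (x i.1 i.2) with hΨ'
  set ρ : ℝ → ℝ := fun h => C * |h| ^ (((N + 1 : ℕ) : ℝ) / p) with hρdef
  have hρ : ρ =o[𝓝 0] (fun h : ℝ => h) := (isLittleO_abs_rpow hr).const_mul_left C
  have hρ0 : ∀ h, 0 ≤ ρ h := fun h => by positivity
  have hω1 : ∀ i ∈ simplex T, ω i.1 i.2 ^ (1 / p) ≤ ω 0 T ^ (1 / p) := fun i hi =>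
    Real.rpow_le_rpow (hω0 i hi) (hω.le_total hi.1 hi.2.1 hi.2.2) (by positivity)
  have hloc' : ∀ i ∈ simplex T, ω i.1 i.2 ≤ δ ^ p →
      Ψ i ∈ φ.source ∧ ‖φ (Ψ i) - Ψ' i‖ ≤ ρ (ω i.1 i.2) := by
    intro i hi hi'
    obtain ⟨g, hg, hxg, hb⟩ := hgl i hi
    have h := hloc (y i.1) (hsK i hi) g hg (ω i.1 i.2 ^ (1 / p))
      (Real.rpow_nonneg (hω0 i hi) _) ?_ hb
    · rw [hpow i hi, ← hxg] at h
      simpa only [hρdef, hΨ, hΨ', abs_of_nonneg (hω0 i hi)] using h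
    · have := Real.rpow_le_rpow (hω0 i hi) hi' (by positivity : 0 ≤ 1 / p)
      rwa [← Real.rpow_mul hδ.le, mul_one_div_cancel hp0.ne', Real.rpow_one] at this
  have hbd : ∀ i ∈ simplex T, ‖Ψ i‖ ≤ R₁ ∧ ‖Ψ' i‖ ≤ R₂ := by
    intro i hi
    obtain ⟨g, hg, hxg, hb⟩ := hgl i hi
    have h₁ := hR₁ (y i.1) (hsK i hi) g hg _ (Real.rpow_nonneg (hω0 i hi) _) (hω1 i hi) hb
    have h₂ := hR₂ (y i.1) (hsK i hi) g hg _ (Real.rpow_nonneg (hω0 i hi) _) (hω1 i hi) hb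
    rw [← elemDiff_canonical, ← hxg] at h₁
    rw [← elemDiff_pushforward hφ hφ' hVsmooth (hKU (hsK i hi)), ← hxg] at h₂
    exact ⟨h₁, h₂⟩
  rw [solvesRDE_iff, solvesRDE_iff]
  constructor
  -- `φ` is Lipschitz near `y t`. The maximum with 1 accounts for the change of variables error,
  -- which enters with coefficient 1.
  · refine exists_isLittleO_of_local_bound (δ := min (δ ^ p) δ₁) (L := max L₁ 1)
      (R := S₂ + R₂) hρ (by positivity) (by positivity) (fun i hi hwi hei _ => ?_) (fun i hi => ?_)
    · obtain ⟨-, hrem⟩ := hloc' i hi (hwi.trans (min_le_left _ _))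
      have hei' : ‖Ψ i - y i.2‖ ≤ δ₁ := by
        rw [norm_sub_rev]
        exact hei.trans (min_le_right _ _)
      have h := hLip₁ (y i.2) (htK i hi) (Ψ i) hei'
      have h₁ : ‖φ (y i.2) - Ψ' i‖ ≤ ‖φ (Ψ i) - φ (y i.2)‖ + ‖φ (Ψ i) - Ψ' i‖ := by
        rw [norm_sub_rev (φ (Ψ i)) (φ (y i.2))]
        exact norm_sub_le_norm_sub_add_norm_sub _ _ _
      rw [norm_sub_rev (Ψ i)] at h
      refine h₁.trans ((add_le_add h hrem).trans ?_)
      rw [mul_add]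
      refine add_le_add (mul_le_mul_of_nonneg_right (le_max_left _ _) (norm_nonneg _)) ?_
      exact le_mul_of_one_le_left (hρ0 _) (le_max_right _ _)
    · exact (norm_sub_le _ _).trans (add_le_add (hS₂ _ ⟨_, htK i hi, rfl⟩) (hbd i hi).2)
  -- Here the inverse of `φ` is Lipschitz near `φ (y t)`. The distance from there to `φ (Ψ i)` is at
  -- most the solution error plus the change of variables error, each allowed half of `δ₂`.
  · refine exists_isLittleO_of_local_bound (δ := min (δ ^ p) (δ₂ / 2)) (L := L₂)
      (R := S₁ + R₁) hρ (by positivity) hL₂ (fun i hi hwi hei hρi => ?_) (fun i hi => ?_)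
    · obtain ⟨hsrc, hrem⟩ := hloc' i hi (hwi.trans (min_le_left _ _))
      have h₁ : ‖φ (Ψ i) - φ (y i.2)‖ ≤ ‖φ (y i.2) - Ψ' i‖ + ρ (ω i.1 i.2) := by
        rw [add_comm, norm_sub_rev (φ (y i.2))]
        exact (norm_sub_le_norm_sub_add_norm_sub _ (Ψ' i) _).trans (add_le_add hrem le_rfl)
      have h₂ := hLip₂ (φ (y i.2)) ⟨_, htK i hi, rfl⟩ (φ (Ψ i)) (h₁.trans
        ((add_le_add (hei.trans (min_le_right _ _)) (hρi.trans (min_le_right _ _))).trans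
          (add_halves δ₂).le))
      rw [φ.left_inv hsrc, φ.left_inv (hKU (htK i hi)), norm_sub_rev] at h₂
      exact h₂.trans (mul_le_mul_of_nonneg_left h₁ hL₂)
    · exact (norm_sub_le _ _).trans (add_le_add (hS₁ _ (htK i hi)) (hbd i hi).1)
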